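/- Let $0<H<1$ and let $B=(B_t)_{t\in\mathbb R}$ be a standard fractional Brownian motion with Hurst exponent $H$ (a centred Gaussian process with a.s. continuous paths and $\operatorname{Cov}(B_s,B_t)=\tfrac12(|s|^{2H}+|t|^{2H}-|s-t|^{2H})$). Let $\psi:\mathbb R\to\mathbb R$ be a wavelet, $\int(1+|t|)|\psi(t)|\,dt<\infty$ and $\int\psi=0$, and let $$d_{j,k}=\int_{\mathbb R}B_t\,2^{j/2}\psi\big(2^j(t-k)\big)\,dt$$ be the non-decimated wavelet coefficients; assume that the variance $\sigma^2$ of the level-$0$ coefficients is positive. For positive integers $J,M$ and $N$ a multiple of $2M$ put $$D_{j,k}=\tfrac12\big(d_{j,k}^2+d_{j,k+N/2}^2\big)\quad(1\le j\le J,\ 1\le k\le N/2),$$ $$L(i,j)=\{\log D_{j,i},\log D_{j,i+M},\dots,\log D_{j,N/2-M+i}\}\quad(1\le i\le M).$$ Assume that, for all large $N$ and all such $j,k,i$, the variables $d_{j,k}$ and $d_{j,k+N/2}$ are independent, and the $N/(2M)$ members of $L(i,j)$ are independent. For a sample of size $n$ let $Y_p$ be its $\lfloor np\rfloor$-th smallest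 element. Let $\hat\mu^T_{j,i}=\frac14Y_{1/4}+\frac12Y_{1/2}+\frac14Y_{3/4}$ (Tukey's trimean) and $\hat\mu^G_{j,i}=0.3\,Y_{1/3}+0.4\,Y_{1/2}+0.3\,Y_{2/3}$ (Gastwirth estimator), computed from the sample $L(i,j)$. Then, with $M$ and $J$ fixed and $N\to\infty$ along multiples of $2M$, for all $1\le j\le J$, $1\le i\le M$, $$\frac{\hat\mu^T_{j,i}-m^T_j}{\sqrt{V_1}}\to\mathcal N(0,1),\qquad \frac{\hat\mu^G_{j,i}-m^G_j}{\sqrt{V_2}}\to\mathcal N(0,1)\quad\text{in distribution},$$ where $m^T_j=-(2H+1)(\log 2)\,j+c_3$, $m^G_j=-(2H+1)(\log 2)\,j+c_4$, with the following constants independent of $j$: $$c_3=-\log2+\log\sigma^2+\tfrac14\log\!\big(\log\tfrac{16}9\cdot\log16\big)+\tfrac12\log\log4,$$ $$c_4=-\log2+\log\sigma^2+0.3\log\log\tfrac94+0.4\log\log4+0.3\log\log9,$$ $$V_1=\tfrac{M}{2N}\Big(\tfrac{1}{12(\log\frac34)^2}+\tfrac{1}{3\log\frac34\log\frac12}+\tfrac1{6\log\frac34\log\frac14}+\tfrac1{(\log\frac12)^2}+\tfrac1{\log\frac12\log\frac14}+\tfrac3{4(\log\frac14)^2}\Big),$$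 $$V_2=\tfrac{2M}{N}\Big(\tfrac{0.09}{2(\log\frac23)^2}+\tfrac{0.12}{\log\frac23\log\frac12}+\tfrac{0.09}{\log\frac13\log\frac23}+\tfrac{0.16}{(\log\frac12)^2}+\tfrac{0.24}{\log\frac12\log\frac13}+\tfrac{0.18}{(\log\frac13)^2}\Big).$$ Moreover, if $J\ge2$, the Hurst exponent can be estimated by $$\hat H^T=-\frac{\bar\beta^T}{2\log2}-\frac12,\qquad \hat H^G=-\frac{\bar\beta^G}{2\log2}-\frac12,$$ where $\bar\beta^T$ and $\bar\beta^G$ are the averages over $i=1,\dots,M$ of the least squares regression slopes on the pairs $(j,\hat\mu^T_{j,i})$ and $(j,\hat\mu^G_{j,i})$, $1\le j\le J$. That is: the same formula applied to the regression slope on the pairs $(j,m^T_j)$, respectively $(j,m^G_j)$, gives exactly $H$, and $\hat H^T\to H$ and $\hat H^G\to H$ in probability as $N\to\infty$. -/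

import Mathlib

open MeasureTheory ProbabilityTheory Filter Topology

noncomputable section

namespace TrimeanHurst

/-- Standard fractional Brownian motion on `ℝ` with Hurst exponent `H`: a centred Gaussian process
with the fractional covariance and almost surely continuous paths. -/
structure IsFBM {Ω : Type*} [MeasurableSpace Ω] (B : ℝ → Ω → ℝ) (H : ℝ) (P : Measure Ω) :
    Prop where
  gaussian : IsGaussianProcess B P
  centred : ∀ t : ℝ, ∫ ω, B t ω ∂P = 0
  covariance_eq : ∀ s t : ℝ, covariance (B s) (B t) P =
    (|s| ^ (2 * H) + |t| ^ (2 * H) - |s - t| ^ (2 * H)) / 2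
  continuous_paths : ∀ᵐ ω ∂P, Continuous fun t : ℝ => B t ω

/-- A (real) wavelet: `(1 + |t|) ψ(t)` is integrable and `ψ` has mean zero. Neither orthogonality of
its translates and dilates, nor smoothness, nor compact support is required. -/
structure IsWavelet (ψ : ℝ → ℝ) : Prop where
  integrable_weighted : Integrable (fun t : ℝ => (1 + |t|) * ψ t)
  integral_eq_zero : ∫ t : ℝ, ψ t = 0

/-- The non-decimated wavelet atom `ψ_{j,k}(t) = 2^{j/2} ψ(2^j (t - k))`: the shift `k` runs over
the same grid at every level. -/
def atom (ψ : ℝ → ℝ) (j k : ℕ) (t : ℝ) : ℝ :=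
  (2 : ℝ) ^ ((j : ℝ) / 2) * ψ ((2 : ℝ) ^ j * (t - (k : ℝ)))

section Coefficients

variable {Ω : Type*}

/-- The non-decimated wavelet coefficient `d_{j,k}` of the path of `B`. -/
def coeff (ψ : ℝ → ℝ) (B : ℝ → Ω → ℝ) (j k : ℕ) (ω : Ω) : ℝ :=
  ∫ t : ℝ, B t ω * atom ψ j k t

/-- The mid-energy `D_{j,k} = (d_{j,k}² + d_{j,k+N/2}²) / 2`, for `1 ≤ k ≤ N/2`. -/
def midEnergy (ψ : ℝ → ℝ) (B : ℝ → Ω → ℝ) (N j k : ℕ) (ω : Ω) : ℝ :=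
  (coeff ψ B j k ω ^ 2 + coeff ψ B j (k + N / 2) ω ^ 2) / 2

/-- The `i`-th group of logged mid-energies at level `j`: the `(N/2)/M` numbers
`log D_{j,i}, log D_{j,i+M}, …, log D_{j,N/2-M+i}`, for `1 ≤ i ≤ M`. -/
def logGroup (ψ : ℝ → ℝ) (B : ℝ → Ω → ℝ) (N M j i : ℕ) (ω : Ω) (m : Fin (N / 2 / M)) : ℝ :=
  Real.log (midEnergy ψ B N j (i + (m : ℕ) * M) ω)

end Coefficients

/-- The order statistic `x_{k:n}`, the `k`-th smallest of `x 0, …, x (n-1)`, for `1 ≤ k ≤ n`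
(and `0` for other `k`). -/
def orderStat {n : ℕ} (x : Fin n → ℝ) (k : ℕ) : ℝ :=
  if h : 1 ≤ k ∧ k ≤ n then x (Tuple.sort x ⟨k - 1, by omega⟩) else 0

/-- The sample `p`-quantile `Y_p = x_{⌊np⌋:n}`. -/
def sampleQuantile {n : ℕ} (x : Fin n → ℝ) (p : ℝ) : ℝ :=
  orderStat x ⌊(n : ℝ) * p⌋₊

/-- The general trimean estimator `(α/2) Y_p + (1 - α) Y_{1/2} + (α/2) Y_{1-p}`. -/
def generalTrimean (α p : ℝ) {n : ℕ} (x : Fin n → ℝ) : ℝ :=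
  α / 2 * sampleQuantile x p + (1 - α) * sampleQuantile x (1 / 2) +
    α / 2 * sampleQuantile x (1 - p)

/-- Tukey's trimean, `(1/4) Y_{1/4} + (1/2) Y_{1/2} + (1/4) Y_{3/4}`. -/
def tukey {n : ℕ} (x : Fin n → ℝ) : ℝ := generalTrimean (1 / 2) (1 / 4) x

/-- The Gastwirth estimator, `0.3 Y_{1/3} + 0.4 Y_{1/2} + 0.3 Y_{2/3}`. -/
def gastwirth {n : ℕ} (x : Fin n → ℝ) : ℝ := generalTrimean (3 / 5) (1 / 3) x

/-- The mean of the levels `1, …, J`. -/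
def levelMean (J : ℕ) : ℝ := (∑ j ∈ Finset.Icc 1 J, (j : ℝ)) / J

/-- The slope of the least squares regression line through the points `(j, y j)`, `1 ≤ j ≤ J`. -/
def olsSlope (J : ℕ) (y : ℕ → ℝ) : ℝ :=
  (∑ j ∈ Finset.Icc 1 J, ((j : ℝ) - levelMean J) * y j) /
    ∑ j ∈ Finset.Icc 1 J, ((j : ℝ) - levelMean J) ^ 2

/-- The estimator `-β̄ / (2 log 2) - 1/2` of the Hurst exponent, where `β̄` is the average over
`i = 1, …, M` of the regression slopes on the pairs `(j, y j i)`, `1 ≤ j ≤ J`. -/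
def hurstEst (J M : ℕ) (y : ℕ → ℕ → ℝ) : ℝ :=
  -(1 / (2 * Real.log 2)) *
      ((1 / (M : ℝ)) * ∑ i ∈ Finset.Icc 1 M, olsSlope J fun j => y j i) - 1 / 2

/-- The level-free part `c₃` of the asymptotic mean of Tukey's trimean; `σ` is the standard
deviation of the wavelet coefficients at level `0`. -/
def c₃ (σ : ℝ) : ℝ :=
  -Real.log 2 + Real.log (σ ^ 2) + 1 / 4 * Real.log (Real.log (16 / 9) * Real.log 16) +
    1 / 2 * Real.log (Real.log 4)

/-- The level-free part `c₄` of the asymptotic mean of the Gastwirth estimator. -/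
def c₄ (σ : ℝ) : ℝ :=
  -Real.log 2 + Real.log (σ ^ 2) + 3 / 10 * Real.log (Real.log (9 / 4)) +
    2 / 5 * Real.log (Real.log 4) + 3 / 10 * Real.log (Real.log 9)

/-- The asymptotic variance `V₁` of Tukey's trimean. -/
def V₁ (M N : ℕ) : ℝ :=
  (M : ℝ) / (2 * N) *
    (1 / (12 * Real.log (3 / 4) ^ 2) + 1 / (3 * Real.log (3 / 4) * Real.log (1 / 2)) +
      1 / (6 * Real.log (3 / 4) * Real.log (1 / 4)) + 1 / Real.log (1 / 2) ^ 2 +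
      1 / (Real.log (1 / 2) * Real.log (1 / 4)) + 3 / (4 * Real.log (1 / 4) ^ 2))

/-- The asymptotic variance `V₂` of the Gastwirth estimator. -/
def V₂ (M N : ℕ) : ℝ :=
  2 * (M : ℝ) / N *
    (0.09 / (2 * Real.log (2 / 3) ^ 2) + 0.12 / (Real.log (2 / 3) * Real.log (1 / 2)) +
      0.09 / (Real.log (1 / 3) * Real.log (2 / 3)) + 0.16 / Real.log (1 / 2) ^ 2 +
      0.24 / (Real.log (1 / 2) * Real.log (1 / 3)) + 0.18 / Real.log (1 / 3) ^ 2)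

end TrimeanHurst

end

open TrimeanHurst

open scoped NNReal ENNReal

/-! Wavelet side. Each coefficient is centred Gaussian with variance `2^(-(2H+1)j) σ²`
(`exists_map_coeff`). Since `ψ` has mean zero, the path may be replaced by its increments from time
`k`; by self-similarity these have, after rescaling time by `2^(-j)`, the covariance of `B` times
`2^(-2Hj)`, and normalisation together with the change of variables contributes `2^(-j)`. The path
integral is Gaussian because it is an almost sure limit of Riemann sums. Their variances involve the
covariance function alone, so proportional covariances give proportional limiting variances
(`exists_law_integral`).

Half the sum of squares of two independent such variables of variance `v` is exponential of mean
`v`. Its logarithm has distribution function `1 - exp(-e^x / v)`, with `p`-quantile `log v +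
log(-log(1-p))` and density `-(1-p) log(1-p)` there. The level therefore enters only through the
shift `log v`, affine in `j` with slope `-(2H+1) log 2`, while the asymptotic variance is free of
`j`.

Statistical side. By the Bahadur representation (`tendstoInMeasure_sampleQuantile_sub`), `√n (Y_p -
q)` differs by `o(1)` in probability from a normalised sum of i.i.d. influence variables. The
central limit theorem then covers any finite combination of quantiles, with covariances `(min p p' -
p p') / (f f')`. Convergence in distribution sees only the law of each row, so it suffices to treat
one i.i.d. sequence and transfer the result to the triangular array.

Consistency follows because the scales `√V₁`, `√V₂` vanish, the Hurst estimator is affine in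
finitely many trimeans, and least squares recovers the slope of an affine function. -/

/-! ### Order statistics and counting functions -/

/-- Sorting permutes the sample, so it preserves the number of entries at most `c`, and in a
monotone list these fill an initial segment. Quantile events thus become events about sums of
indicators. -/
lemma orderStat_le_iff {n k : ℕ} (x : Fin n → ℝ) (hk : 1 ≤ k) (hkn : k ≤ n) (c : ℝ) :
    orderStat x k ≤ c ↔ k ≤ (Finset.univ.filter fun i => x i ≤ c).card := by
  have h : 1 ≤ k ∧ k ≤ n := ⟨hk, hkn⟩
  have hcard : (Finset.univ.filter fun i => x i ≤ c).card =
      (Finset.univ.filter fun i => (x ∘ Tuple.sort x) i ≤ c).card := by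
    refine (Finset.card_equiv (Tuple.sort x) fun i => ?_).symm
    simp
  -- Sorted positions start at `0`: the `k`-th smallest sits at index `k - 1`, and `k - 1 < card`
  -- reads `k ≤ card`.
  have := Tuple.lt_card_le_iff_apply_le_of_monotone (f := x ∘ Tuple.sort x) (a := c)
    (j := ⟨k - 1, by omega⟩) (Tuple.monotone_sort x)
  rw [orderStat, dif_pos h, hcard]
  rw [Function.comp_apply] at this
  rw [← this]
  change k - 1 < _ ↔ _
  omega

lemma measurable_orderStat {n : ℕ} (k : ℕ) :
    Measurable fun x : Fin n → ℝ => orderStat x k := by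
  by_cases h : 1 ≤ k ∧ k ≤ n
  · refine measurable_of_Iic fun c => ?_
    have : (fun x : Fin n → ℝ => orderStat x k) ⁻¹' Set.Iic c =
        {x | (k : ℝ) ≤ ∑ i, (Set.Iic c).indicator (fun _ => (1 : ℝ)) (x i)} := by
      ext x
      simp only [Set.mem_preimage, Set.mem_Iic, Set.mem_ofPred_eq, orderStat_le_iff x h.1 h.2,
        Set.indicator_apply]
      rw [Finset.sum_boole]
      exact_mod_cast Iff.rfl
    rw [this]
    have hm : Measurable ((Set.Iic c).indicator fun _ : ℝ => (1 : ℝ)) :=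
      measurable_const.indicator measurableSet_Iic
    exact measurableSet_le measurable_const
      (Finset.measurable_sum _ fun i _ => hm.comp (measurable_pi_apply i))
  · simp only [orderStat, dif_neg h]
    exact measurable_const

lemma measurable_sampleQuantile {n : ℕ} (p : ℝ) :
    Measurable fun x : Fin n → ℝ => sampleQuantile x p := measurable_orderStat _

lemma measurable_generalTrimean (α p : ℝ) {n : ℕ} :
    Measurable fun x : Fin n → ℝ => generalTrimean α p x :=
  (((measurable_sampleQuantile p).const_mul _).add
    ((measurable_sampleQuantile _).const_mul _)).add ((measurable_sampleQuantile _).const_mul _)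

/-! ### The Bahadur representation -/

/-- **Ghosh's lemma**: two sequences of random variables that eventually lie on the same side of
every fixed level, one of them being tight, are asymptotically equal in probability. -/
lemma tendstoInMeasure_sub_of_same_side {Ω : Type*} [MeasurableSpace Ω] {P : Measure Ω}
    {V W : ℕ → Ω → ℝ}
    (htight : ∀ δ : ENNReal, 0 < δ → ∃ K : ℝ, ∀ n, P {ω | K ≤ |W n ω|} ≤ δ)
    (h₁ : ∀ t ε : ℝ, 0 < ε → Tendsto (fun n => P {ω | V n ω ≤ t ∧ t + ε ≤ W n ω}) atTop (𝓝 0))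
    (h₂ : ∀ t ε : ℝ, 0 < ε → Tendsto (fun n => P {ω | t + ε ≤ V n ω ∧ W n ω ≤ t}) atTop (𝓝 0)) :
    TendstoInMeasure P (V - W) atTop 0 := by
  rw [tendstoInMeasure_iff_norm]
  intro ε hε
  rw [ENNReal.tendsto_nhds_zero]
  intro δ hδ
  obtain ⟨K, hK⟩ := htight (δ / 2) (ENNReal.half_pos hδ.ne')
  -- With mesh `ε / 2`, a gap of at least `ε` between `V` and `W` contains a whole cell adjacent to
  -- the cell of `W`. When `|W| < K`, finitely many such cells suffice.
  set g := ε / 2 with hg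
  have hgpos : 0 < g := by positivity
  obtain ⟨Z, hZ⟩ := exists_nat_ge (K / g + 1)
  set I : Finset ℤ := Finset.Icc (-(Z : ℤ)) Z
  have hsub : ∀ n, {ω | ε ≤ ‖(V - W) n ω - (0 : ℕ → Ω → ℝ) n ω‖} ⊆ {ω | K ≤ |W n ω|} ∪
      ⋃ z ∈ I, ({ω | V n ω ≤ g * z - g ∧ (g * z - g) + g ≤ W n ω} ∪
        {ω | (g * z + g) + g ≤ V n ω ∧ W n ω ≤ g * z + g}) := by
    intro n ω hω
    simp only [Set.mem_ofPred_eq, Pi.sub_apply, Pi.zero_apply, sub_zero, Real.norm_eq_abs] at hω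
    by_cases hW : K ≤ |W n ω|
    · exact Or.inl hW
    · right
      push Not at hW
      have hfl := Int.floor_le (W n ω / g)
      have hfl2 := Int.lt_floor_add_one (W n ω / g)
      rw [le_div_iff₀ hgpos] at hfl
      rw [div_lt_iff₀ hgpos] at hfl2
      obtain ⟨hW1, hW2⟩ := abs_lt.1 hW
      have hKZ : K + g ≤ Z * g := by
        have := mul_le_mul_of_nonneg_right hZ hgpos.le
        rwa [add_mul, div_mul_cancel₀ _ hgpos.ne', one_mul] at this
      have hz : ⌊W n ω / g⌋ ∈ I := by
        rw [Finset.mem_Icc]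
        constructor
        · have : (-(Z : ℝ)) < ⌊W n ω / g⌋ + 1 := by
            by_contra hcon
            push Not at hcon
            nlinarith
          have : (-(Z : ℤ)) < ⌊W n ω / g⌋ + 1 := by exact_mod_cast this
          omega
        · have : (⌊W n ω / g⌋ : ℝ) ≤ Z := by
            by_contra hcon
            push Not at hcon
            nlinarith
          exact_mod_cast this
      simp only [Set.mem_iUnion]
      refine ⟨_, hz, ?_⟩
      rcases le_abs'.1 hω with h | h
      · left
        constructor <;> nlinarith
      · right
        constructor <;> nlinarith
  have hlim : Tendsto (fun n => ∑ z ∈ I,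
      (P {ω | V n ω ≤ g * z - g ∧ (g * z - g) + g ≤ W n ω} +
        P {ω | (g * z + g) + g ≤ V n ω ∧ W n ω ≤ g * z + g})) atTop (𝓝 0) := by
    have := tendsto_finsetSum I fun z _ =>
      (h₁ (g * z - g) g hgpos).add (h₂ (g * z + g) g hgpos)
    simpa using this
  filter_upwards [(ENNReal.tendsto_nhds_zero.1 hlim) (δ / 2) (ENNReal.half_pos hδ.ne')] with n hn
  calc P {ω | ε ≤ ‖(V - W) n ω - (0 : ℕ → Ω → ℝ) n ω‖} ≤ _ := measure_mono (hsub n)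
    _ ≤ _ := measure_union_le _ _
    _ ≤ δ / 2 + ∑ z ∈ I,
      (P {ω | V n ω ≤ g * z - g ∧ (g * z - g) + g ≤ W n ω} +
        P {ω | (g * z + g) + g ≤ V n ω ∧ W n ω ≤ g * z + g}) := by
        refine add_le_add (hK n) ((measure_biUnion_finset_le _ _).trans ?_)
        exact Finset.sum_le_sum fun z _ => measure_union_le _ _
    _ ≤ δ / 2 + δ / 2 := by gcongr
    _ = δ := ENNReal.add_halves δ

/-- Chebyshev's inequality for the centred partial sums of a bounded function of an i.i.d.
sequence. -/
lemma meas_centred_sum_ge_le {Ω : Type*} [MeasurableSpace Ω] {P : Measure Ω}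
    [IsProbabilityMeasure P] {ν : Measure ℝ} [IsProbabilityMeasure ν] {X : ℕ → Ω → ℝ}
    (hX : ∀ m, Measurable (X m)) (hind : iIndepFun X P) (hlaw : ∀ m, P.map (X m) = ν)
    {g : ℝ → ℝ} (hg : Measurable g) (hb : ∀ x, |g x| ≤ 1) {a : ℝ} (ha : 0 < a) {n : ℕ}
    (hn : 0 < n) :
    P {ω | a * √n ≤ |∑ m ∈ Finset.range n, g (X m ω) - n * ∫ x, g x ∂ν|} ≤
      ENNReal.ofReal ((∫ x, g x ^ 2 ∂ν) / a ^ 2) := by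
  have hL : ∀ m, MemLp (fun ω => g (X m ω)) 2 P := fun m =>
    MemLp.of_bound (hg.comp (hX m)).aestronglyMeasurable 1 (ae_of_all _ fun ω => by
      simpa using hb (X m ω))
  have hmean : ∀ m, ∫ ω, g (X m ω) ∂P = ∫ x, g x ∂ν := fun m => by
    rw [← hlaw m, integral_map (hX m).aemeasurable hg.aestronglyMeasurable]
  have hsq : ∀ m, ∫ ω, g (X m ω) ^ 2 ∂P = ∫ x, g x ^ 2 ∂ν := fun m => by
    rw [← hlaw m, integral_map (hX m).aemeasurable (hg.pow_const 2).aestronglyMeasurable]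
  have hLs : MemLp (∑ m ∈ Finset.range n, fun ω => g (X m ω)) 2 P :=
    memLp_finsetSum' _ fun m _ => hL m
  have hvar : variance (∑ m ∈ Finset.range n, fun ω => g (X m ω)) P ≤ n * ∫ x, g x ^ 2 ∂ν := by
    rw [IndepFun.variance_sum (fun m _ => hL m) (fun i _ j _ hij =>
      (hind.indepFun hij).comp hg hg)]
    calc _ ≤ ∑ m ∈ Finset.range n, ∫ x, g x ^ 2 ∂ν := by
          refine Finset.sum_le_sum fun m _ => ?_
          rw [← hsq m]
          exact variance_le_expectation_sq (hL m).aestronglyMeasurable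
      _ = _ := by simp
  have hint : ∫ ω, (∑ m ∈ Finset.range n, fun ω => g (X m ω)) ω ∂P = n * ∫ x, g x ∂ν := by
    simp only [Finset.sum_apply]
    rw [integral_finsetSum _ fun m _ => (hL m).integrable (by norm_num)]
    simp [hmean]
  have hn' : (0 : ℝ) < n := by exact_mod_cast hn
  have hc : 0 < a * √n := by positivity
  have := meas_ge_le_variance_div_sq hLs hc
  rw [hint] at this
  simp only [Finset.sum_apply] at this
  refine this.trans (ENNReal.ofReal_le_ofReal ?_)
  rw [mul_pow, Real.sq_sqrt hn'.le, div_le_div_iff₀ (by positivity) (by positivity)]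
  calc _ ≤ (n * ∫ x, g x ^ 2 ∂ν) * a ^ 2 := by gcongr
    _ = _ := by ring

/-- The normalised influence function `(p - 1_{x ≤ q}) / f` of the `p`-quantile `q` of a law with
density `f` at `q`. -/
noncomputable def quantileInfluence (p q f x : ℝ) : ℝ :=
  (p - (Set.Iic q).indicator (fun _ => (1 : ℝ)) x) / f

lemma measurable_quantileInfluence (p q f : ℝ) : Measurable (quantileInfluence p q f) :=
  ((measurable_const.sub (measurable_const.indicator measurableSet_Iic))).div_const _

lemma abs_indicator_one_le (s : Set ℝ) (x : ℝ) : |s.indicator (fun _ => (1 : ℝ)) x| ≤ 1 := by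
  by_cases h : x ∈ s <;> simp [h]

lemma integral_indicator_Iic (ν : Measure ℝ) (c : ℝ) :
    ∫ x, (Set.Iic c).indicator (fun _ => (1 : ℝ)) x ∂ν = ν.real (Set.Iic c) := by
  rw [integral_indicator measurableSet_Iic]
  simp

lemma integrable_indicator_Iic (ν : Measure ℝ) [IsFiniteMeasure ν] (c : ℝ) :
    Integrable ((Set.Iic c).indicator fun _ => (1 : ℝ)) ν :=
  (integrable_const _).indicator measurableSet_Iic

/-- Once `q ≤ c`, the difference is the indicator of the interval between them, hence its own
square. Its mass is what makes the empirical increment near `q` negligible. -/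
lemma integral_sq_indicator_sub (ν : Measure ℝ) [IsFiniteMeasure ν] (c q : ℝ) :
    ∫ x, ((Set.Iic c).indicator (fun _ => (1 : ℝ)) x -
      (Set.Iic q).indicator (fun _ => (1 : ℝ)) x) ^ 2 ∂ν =
      |ν.real (Set.Iic c) - ν.real (Set.Iic q)| := by
  wlog h : q ≤ c generalizing c q
  · rw [abs_sub_comm, ← this q c (le_of_not_ge h)]
    congr with x
    ring
  have hsq : ∀ x, ((Set.Iic c).indicator (fun _ => (1 : ℝ)) x -
      (Set.Iic q).indicator (fun _ => (1 : ℝ)) x) ^ 2 = (Set.Iic c).indicator (fun _ => (1 : ℝ)) x -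
      (Set.Iic q).indicator (fun _ => (1 : ℝ)) x := by
    intro x
    simp only [Set.indicator_apply, Set.mem_Iic]
    by_cases h1 : x ≤ q
    · simp [h1, h1.trans h]
    · by_cases h2 : x ≤ c <;> simp [h1, h2]
  simp_rw [hsq]
  rw [integral_sub (integrable_indicator_Iic ν c) (integrable_indicator_Iic ν q),
    integral_indicator_Iic, integral_indicator_Iic, abs_of_nonneg]
  exact sub_nonneg.2 (measureReal_mono (Set.Iic_subset_Iic.2 h))

lemma tendsto_inv_sqrt_nat : Tendsto (fun n : ℕ => (√(n : ℝ))⁻¹) atTop (𝓝 0) :=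
  tendsto_inv_atTop_zero.comp (Real.tendsto_sqrt_atTop.comp tendsto_natCast_atTop_atTop)

/-- This is the difference quotient of `u ↦ F (q + t * u)` at `0` along `u = 1 / √n`, the scale of
the error of a sample quantile. -/
lemma tendsto_sqrt_mul_sub_of_hasDerivAt {F : ℝ → ℝ} {q f : ℝ} (hF : HasDerivAt F f q) (t : ℝ) :
    Tendsto (fun n : ℕ => √(n : ℝ) * (F (q + t / √(n : ℝ)) - F q)) atTop (𝓝 (t * f)) := by
  have hd : HasDerivAt (fun u : ℝ => F (q + t * u)) (t * f) 0 := by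
    have h1 : HasDerivAt (fun u : ℝ => q + t * u) t 0 := by
      simpa using ((hasDerivAt_id (0 : ℝ)).const_mul t).const_add q
    have h2 : HasDerivAt F f (q + t * 0) := by simpa using hF
    simpa [mul_comm, Function.comp_def] using h2.comp (0 : ℝ) h1
  have hlim : Tendsto (fun n : ℕ => (√(n : ℝ))⁻¹) atTop (𝓝[>] 0) := by
    refine tendsto_nhdsWithin_iff.2 ⟨tendsto_inv_sqrt_nat, ?_⟩
    filter_upwards [eventually_gt_atTop 0] with n hn
    have : (0 : ℝ) < n := by exact_mod_cast hn
    exact Set.mem_Ioi.2 (by positivity)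
  have := hd.tendsto_slope_zero_right.comp hlim
  refine this.congr fun n => ?_
  simp [div_eq_mul_inv]

lemma sampleQuantile_le_iff {n : ℕ} {p : ℝ} (hp : p < 1) (hn : 1 ≤ n * p) (x : ℕ → ℝ) (c : ℝ) :
    sampleQuantile (fun i : Fin n => x i) p ≤ c ↔ (⌊(n : ℝ) * p⌋₊ : ℝ) ≤
      ∑ m ∈ Finset.range n, (Set.Iic c).indicator (fun _ => (1 : ℝ)) (x m) := by
  have h1 : 1 ≤ ⌊(n : ℝ) * p⌋₊ := Nat.le_floor (by simpa using hn)
  have h2 : ⌊(n : ℝ) * p⌋₊ ≤ n := Nat.floor_le_of_le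
    (by nlinarith [(Nat.cast_nonneg n : (0 : ℝ) ≤ n)])
  rw [sampleQuantile, orderStat_le_iff _ h1 h2, Finset.sum_range]
  simp only [Set.indicator_apply, Set.mem_Iic]
  rw [Finset.sum_boole]
  exact_mod_cast Iff.rfl

/-- **Bahadur representation** of a sample quantile, with a remainder that tends to zero in
probability. -/
theorem tendstoInMeasure_sampleQuantile_sub {Ω : Type*} [MeasurableSpace Ω] {P : Measure Ω}
    [IsProbabilityMeasure P] {ν : Measure ℝ} [IsProbabilityMeasure ν] {X : ℕ → Ω → ℝ}
    (hX : ∀ m, Measurable (X m)) (hind : iIndepFun X P) (hlaw : ∀ m, P.map (X m) = ν)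
    {p q f : ℝ} (hp0 : 0 < p) (hp1 : p < 1) (hq : ν.real (Set.Iic q) = p) (hf : 0 < f)
    (hF : HasDerivAt (fun x => ν.real (Set.Iic x)) f q) :
    TendstoInMeasure P
      ((fun (n : ℕ) ω => √(n : ℝ) * (sampleQuantile (fun i : Fin n => X i ω) p - q)) -
        fun (n : ℕ) ω => (√(n : ℝ))⁻¹ * ∑ m ∈ Finset.range n, quantileInfluence p q f (X m ω))
      atTop 0 := by
  set S : ℕ → ℝ → Ω → ℝ := fun n c ω =>
    ∑ m ∈ Finset.range n, (Set.Iic c).indicator (fun _ => (1 : ℝ)) (X m ω) with hS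
  have hW : ∀ (n : ℕ) ω, (√(n : ℝ))⁻¹ * ∑ m ∈ Finset.range n, quantileInfluence p q f (X m ω) =
      (n * p - S n q ω) / (√n * f) := by
    intro n ω
    simp only [quantileInfluence, hS, ← Finset.sum_div, Finset.sum_sub_distrib]
    simp [field]
  have hgm : ∀ c, Measurable fun x => (Set.Iic c).indicator (fun _ => (1 : ℝ)) x -
      (Set.Iic q).indicator (fun _ => (1 : ℝ)) x := fun c =>
    (measurable_const.indicator measurableSet_Iic).sub
      (measurable_const.indicator measurableSet_Iic)
  have hgb : ∀ c x, |(Set.Iic c).indicator (fun _ => (1 : ℝ)) x -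
      (Set.Iic q).indicator (fun _ => (1 : ℝ)) x| ≤ 1 := by
    intro c x
    by_cases h1 : x ∈ Set.Iic c <;> by_cases h2 : x ∈ Set.Iic q <;> simp [h1, h2]
  have hcheb : ∀ (n : ℕ) (c a : ℝ), 0 < n → 0 < a →
      P {ω | a * √n ≤ |S n c ω - S n q ω - n * (ν.real (Set.Iic c) - p)|} ≤
        ENNReal.ofReal (|ν.real (Set.Iic c) - p| / a ^ 2) := by
    intro n c a hn ha
    have := meas_centred_sum_ge_le hX hind hlaw (hgm c) (hgb c) ha hn
    rw [integral_sq_indicator_sub, integral_sub (integrable_indicator_Iic ν c)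
      (integrable_indicator_Iic ν q), integral_indicator_Iic, integral_indicator_Iic, hq] at this
    simpa only [Finset.sum_sub_distrib] using this
  -- The count over a window of width `|t| / √n` has variance at most `n` times the mass of the
  -- window, which is `o(n)`. By Chebyshev the centred count is `o(√n)` in probability.
  have hlim : ∀ t a : ℝ, 0 < a → Tendsto (fun n : ℕ =>
      P {ω | a * √n ≤ |S n (q + t / √n) ω - S n q ω -
        n * (ν.real (Set.Iic (q + t / √n)) - p)|}) atTop (𝓝 0) := by
    intro t a ha
    have hc : Tendsto (fun n : ℕ => q + t / √(n : ℝ)) atTop (𝓝 q) := by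
      simpa [div_eq_mul_inv] using (tendsto_inv_sqrt_nat.const_mul t).const_add q
    have h1 : Tendsto (fun n : ℕ =>
        ENNReal.ofReal (|ν.real (Set.Iic (q + t / √(n : ℝ))) - p| / a ^ 2)) atTop (𝓝 0) := by
      have := ENNReal.tendsto_ofReal
        ((((hF.continuousAt.tendsto.comp hc).sub_const p).abs).div_const (a ^ 2))
      simpa [hq] using this
    refine tendsto_of_tendsto_of_tendsto_of_le_of_le' tendsto_const_nhds h1
      (Eventually.of_forall fun _ => zero_le) ?_
    filter_upwards [eventually_gt_atTop 0] with n hn using hcheb n _ a hn ha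
  have hlarge : ∀ᶠ n : ℕ in atTop, 0 < n ∧ 1 ≤ (n : ℝ) * p := by
    obtain ⟨N, hN⟩ := exists_nat_ge (1 / p)
    filter_upwards [eventually_gt_atTop 0, eventually_ge_atTop N] with n h1 h2
    refine ⟨h1, ?_⟩
    rw [← div_le_iff₀ hp0]
    exact hN.trans (by exact_mod_cast h2)
  refine tendstoInMeasure_sub_of_same_side ?_ ?_ ?_
  · intro δ hδ
    have hden : Tendsto (fun K : ℕ => ENNReal.ofReal (1 / ((K + 1 : ℝ) * f) ^ 2)) atTop (𝓝 0) := by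
      rw [← ENNReal.ofReal_zero]
      refine ENNReal.tendsto_ofReal ?_
      have h1 : Tendsto (fun K : ℕ => ((K : ℝ) + 1) * f) atTop atTop :=
        (tendsto_atTop_add_const_right _ _ tendsto_natCast_atTop_atTop).atTop_mul_const hf
      simpa [Function.comp_def] using
        tendsto_inv_atTop_zero.comp ((tendsto_pow_atTop (two_ne_zero)).comp h1)
    obtain ⟨K, hK⟩ := ((ENNReal.tendsto_nhds_zero.1 hden) δ hδ).exists
    refine ⟨K + 1, fun n => ?_⟩
    -- Tightness is demanded for every `n`. At `n = 0` the variable vanishes, and the threshold `K +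
    -- 1`, unlike `K`, is surely positive.
    rcases Nat.eq_zero_or_pos n with rfl | hn
    · have : {ω : Ω | (K : ℝ) + 1 ≤ |(√((0 : ℕ) : ℝ))⁻¹ *
          ∑ m ∈ Finset.range 0, quantileInfluence p q f (X m ω)|} = ∅ := by
        ext ω
        simp
        positivity
      rw [this]
      simp
    have hn' : (0 : ℝ) < n := by exact_mod_cast hn
    have hKpos : (0 : ℝ) < (K + 1) * f := by positivity
    have := meas_centred_sum_ge_le hX hind hlaw
      ((measurable_const (a := (1 : ℝ))).indicator (measurableSet_Iic (a := q)))
      (abs_indicator_one_le _) hKpos hn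
    rw [integral_indicator_Iic, hq] at this
    refine le_trans (measure_mono ?_) (this.trans ((ENNReal.ofReal_le_ofReal ?_).trans hK))
    · intro ω hω
      simp only [Set.mem_ofPred_eq, hW] at hω ⊢
      rw [abs_div, abs_of_pos (show 0 < √(n : ℝ) * f by positivity),
        le_div_iff₀ (by positivity), abs_sub_comm] at hω
      calc _ = (K + 1) * (√n * f) := by ring
        _ ≤ _ := hω
    · gcongr
      calc _ ≤ ∫ x, (1 : ℝ) ∂ν := by
            refine integral_mono_of_nonneg (ae_of_all _ fun x => sq_nonneg _)
              (integrable_const _) (ae_of_all _ fun x => ?_)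
            by_cases h : x ≤ q <;> simp [h]
        _ = 1 := by simp
  -- Here at least `⌊n p⌋` points lie at or below `q + t / √n`, but at most `n p - √n f (t + ε)` at
  -- or below `q`. The difference exceeds its mean, about `√n f t`, by order `√n`, which `hlim`
  -- makes unlikely.
  · intro t ε hε
    refine tendsto_of_tendsto_of_tendsto_of_le_of_le' tendsto_const_nhds
      (hlim t (f * ε / 2) (by positivity)) (Eventually.of_forall fun _ => zero_le) ?_
    have hr := tendsto_sqrt_mul_sub_of_hasDerivAt hF t
    -- The extra `(√n)⁻¹` pays for the rounding in `⌊n p⌋`, which may cost one observation.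
    have hr' : Tendsto (fun n : ℕ => √(n : ℝ) *
        (ν.real (Set.Iic (q + t / √(n : ℝ))) - ν.real (Set.Iic q)) + (√(n : ℝ))⁻¹) atTop
        (𝓝 (t * f + 0)) := hr.add tendsto_inv_sqrt_nat
    filter_upwards [hlarge, hr'.eventually_lt_const (show t * f + 0 < t * f + f * ε / 2 by
      have : 0 < f * ε := by positivity
      linarith)] with n hn hrn
    refine measure_mono fun ω hω => ?_
    have hn' : (0 : ℝ) < n := by exact_mod_cast hn.1
    have hsq : 0 < √(n : ℝ) := Real.sqrt_pos.2 hn'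
    simp only [Set.mem_ofPred_eq, hW] at hω ⊢
    obtain ⟨h1, h2⟩ := hω
    have h1' : sampleQuantile (fun i : Fin n => X i ω) p ≤ q + t / √n := by
      rw [← sub_le_iff_le_add', le_div_iff₀ hsq]
      linarith
    rw [sampleQuantile_le_iff hp1 hn.2 (fun m => X m ω)] at h1'
    change _ ≤ S n (q + t / √n) ω at h1'
    have hfl := Nat.lt_floor_add_one ((n : ℝ) * p)
    rw [le_div_iff₀ (by positivity)] at h2
    refine le_trans ?_ (le_abs_self _)
    rw [hq] at hrn
    have hnn : (n : ℝ) = √n * √n := (Real.mul_self_sqrt hn'.le).symm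
    have h3 : √(n : ℝ) * (√n * (ν.real (Set.Iic (q + t / √n)) - p) + (√n)⁻¹) <
        √n * (t * f + f * ε / 2) := mul_lt_mul_of_pos_left hrn hsq
    rw [mul_add, mul_inv_cancel₀ hsq.ne', ← mul_assoc, ← hnn] at h3
    nlinarith
  -- The window ends at `t + ε / 2`, inside the gap, so that `t + ε ≤ V` strictly excludes it.
  -- Rounding is harmless on this side, as `⌊n p⌋ ≤ n p`.
  · intro t ε hε
    refine tendsto_of_tendsto_of_tendsto_of_le_of_le' tendsto_const_nhds
      (hlim (t + ε / 2) (f * ε / 4) (by positivity)) (Eventually.of_forall fun _ => zero_le) ?_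
    have hr := tendsto_sqrt_mul_sub_of_hasDerivAt hF (t + ε / 2)
    filter_upwards [hlarge, hr.eventually_const_lt (show t * f + f * ε / 4 < (t + ε / 2) * f by
      have : 0 < f * ε := by positivity
      linarith)] with n hn hrn
    refine measure_mono fun ω hω => ?_
    have hn' : (0 : ℝ) < n := by exact_mod_cast hn.1
    have hsq : 0 < √(n : ℝ) := Real.sqrt_pos.2 hn'
    simp only [Set.mem_ofPred_eq, hW] at hω ⊢
    obtain ⟨h1, h2⟩ := hω
    have h1' : ¬ sampleQuantile (fun i : Fin n => X i ω) p ≤ q + (t + ε / 2) / √n := by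
      intro hcon
      rw [← sub_le_iff_le_add', le_div_iff₀ hsq] at hcon
      linarith
    rw [sampleQuantile_le_iff hp1 hn.2 (fun m => X m ω), not_le] at h1'
    change S n (q + (t + ε / 2) / √n) ω < _ at h1'
    have hfl := Nat.floor_le (show 0 ≤ (n : ℝ) * p by positivity)
    rw [div_le_iff₀ (by positivity)] at h2
    refine le_trans ?_ (neg_le_abs _)
    rw [hq] at hrn
    have hnn : (n : ℝ) = √n * √n := (Real.mul_self_sqrt hn'.le).symm
    have h3 : √(n : ℝ) * (t * f + f * ε / 4) <
      √(n : ℝ) * (√n * (ν.real (Set.Iic (q + (t + ε / 2) / √n)) - p)) :=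
        mul_lt_mul_of_pos_left hrn hsq
    rw [← mul_assoc, ← hnn] at h3
    nlinarith

/-! ### Central limit theorem for combinations of quantiles -/

/-- Convergence in measure to constants is preserved by finite linear combinations. -/
lemma tendstoInMeasure_sum_mul {Ω ι κ : Type*} [MeasurableSpace Ω] {P : Measure Ω} {l : Filter κ}
    (s : Finset ι) (w : ι → ℝ) {R : ι → κ → Ω → ℝ} {c : ι → ℝ}
    (h : ∀ r ∈ s, TendstoInMeasure P (R r) l fun _ => c r) :
    TendstoInMeasure P (fun n ω => ∑ r ∈ s, w r * R r n ω) l fun _ => ∑ r ∈ s, w r * c r := by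
  simp only [tendstoInMeasure_iff_norm] at h ⊢
  intro ε hε
  set A := ∑ r ∈ s, |w r| with hA
  have hA0 : 0 ≤ A := Finset.sum_nonneg fun _ _ => abs_nonneg _
  -- The `+ 1` allows all weights to vanish and makes `A * (ε / (A + 1))` strictly less than `ε`.
  have hδ : 0 < ε / (A + 1) := by positivity
  have hlim := tendsto_finsetSum s fun r hr => h r hr _ hδ
  simp only [Finset.sum_const_zero] at hlim
  refine tendsto_of_tendsto_of_tendsto_of_le_of_le tendsto_const_nhds hlim (fun _ => zero_le)
    fun n => ?_
  refine le_trans (measure_mono ?_) (measure_biUnion_finset_le s _)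
  intro ω hω
  by_contra hcon
  simp only [Set.mem_iUnion, Set.mem_ofPred_eq, not_exists, not_le, Real.norm_eq_abs] at hcon hω
  rw [← Finset.sum_sub_distrib] at hω
  have : |∑ r ∈ s, (w r * R r n ω - w r * c r)| ≤ A * (ε / (A + 1)) := by
    refine (Finset.abs_sum_le_sum_abs _ _).trans ?_
    rw [hA, Finset.sum_mul]
    refine Finset.sum_le_sum fun r hr => ?_
    rw [← mul_sub, abs_mul]
    exact mul_le_mul_of_nonneg_left (hcon r hr).le (abs_nonneg _)
  have h2 : A * (ε / (A + 1)) < ε := by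
    rw [mul_div_assoc', div_lt_iff₀ (by positivity)]
    nlinarith
  linarith

lemma integral_quantileInfluence {ν : Measure ℝ} [IsProbabilityMeasure ν] {p q : ℝ} (f : ℝ)
    (hq : ν.real (Set.Iic q) = p) : ∫ x, quantileInfluence p q f x ∂ν = 0 := by
  simp only [quantileInfluence]
  rw [integral_div, integral_sub (integrable_const _) (integrable_indicator_Iic ν q),
    integral_indicator_Iic, hq]
  simp

lemma abs_quantileInfluence_le (p q f x : ℝ) : |quantileInfluence p q f x| ≤ (|p| + 1) / |f| := by
  rw [quantileInfluence, abs_div]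
  gcongr
  exact (abs_sub _ _).trans (by gcongr; exact abs_indicator_one_le _ _)

/-- The product of two half-line indicators is that of the shorter half-line, and the monotone
distribution function carries `min q q'` to `min p p'`. The value is the asymptotic covariance of
two sample quantiles. -/
lemma integral_quantileInfluence_mul {ν : Measure ℝ} [IsProbabilityMeasure ν] {p q p' q' : ℝ}
    (f f' : ℝ) (hq : ν.real (Set.Iic q) = p) (hq' : ν.real (Set.Iic q') = p') :
    ∫ x, quantileInfluence p q f x * quantileInfluence p' q' f' x ∂ν =
      (min p p' - p * p') / (f * f') := by
  have hmin : ν.real (Set.Iic (min q q')) = min p p' := by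
    have hmono : Monotone fun x => ν.real (Set.Iic x) := fun a b hab =>
      measureReal_mono (Set.Iic_subset_Iic.2 hab)
    rw [← hq, ← hq']
    exact hmono.map_min
  have hpt : ∀ x, quantileInfluence p q f x * quantileInfluence p' q' f' x =
      (p * p' - p * (Set.Iic q').indicator (fun _ => (1 : ℝ)) x -
        p' * (Set.Iic q).indicator (fun _ => (1 : ℝ)) x +
        (Set.Iic (min q q')).indicator (fun _ => (1 : ℝ)) x) / (f * f') := by
    intro x
    rw [quantileInfluence, quantileInfluence, div_mul_div_comm]
    congr 1
    simp only [Set.indicator_apply, Set.mem_Iic, le_min_iff]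
    by_cases h1 : x ≤ q <;> by_cases h2 : x ≤ q' <;> simp [h1, h2] <;> ring
  simp_rw [hpt]
  have i1 := (integrable_indicator_Iic ν q').const_mul p
  have i2 := (integrable_indicator_Iic ν q).const_mul p'
  have i3 := integrable_indicator_Iic ν (min q q')
  have i0 : Integrable (fun _ : ℝ => p * p') ν := integrable_const _
  have i12 : Integrable (fun x => p * p' - p * (Set.Iic q').indicator (fun _ => (1 : ℝ)) x) ν :=
    i0.sub i1
  have i123 : Integrable (fun x => p * p' - p * (Set.Iic q').indicator (fun _ => (1 : ℝ)) x -
      p' * (Set.Iic q).indicator (fun _ => (1 : ℝ)) x) ν := i12.sub i2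
  rw [integral_div, integral_add i123 i3, integral_sub i12 i2, integral_sub i0 i1,
    integral_const_mul, integral_const_mul, integral_const_mul, integral_indicator_Iic,
    integral_indicator_Iic, integral_indicator_Iic, hmin, hq, hq']
  simp
  ring

/-- **Asymptotic normality of linear combinations of sample quantiles** of an i.i.d. sequence. -/
theorem tendstoInDistribution_sum_sampleQuantile {Ω ι : Type*} [MeasurableSpace Ω] {P : Measure Ω}
    [IsProbabilityMeasure P] {ν : Measure ℝ} [IsProbabilityMeasure ν] {X : ℕ → Ω → ℝ}
    (hX : ∀ m, Measurable (X m)) (hind : iIndepFun X P) (hlaw : ∀ m, P.map (X m) = ν)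
    (s : Finset ι) (w : ι → ℝ) {p q f : ι → ℝ} (hp0 : ∀ r, 0 < p r) (hp1 : ∀ r, p r < 1)
    (hq : ∀ r, ν.real (Set.Iic (q r)) = p r) (hf : ∀ r, 0 < f r)
    (hF : ∀ r, HasDerivAt (fun x => ν.real (Set.Iic x)) (f r) (q r)) :
    TendstoInDistribution
      (fun (n : ℕ) ω => √(n : ℝ) * (∑ r ∈ s, w r * sampleQuantile (fun i : Fin n => X i ω) (p r) -
        ∑ r ∈ s, w r * q r)) atTop (id : ℝ → ℝ) (fun _ => P)
      (gaussianReal 0 (Real.toNNReal (∑ r ∈ s, ∑ r' ∈ s,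
        w r * w r' * ((min (p r) (p r') - p r * p r') / (f r * f r'))))) := by
  set G : ℝ → ℝ := fun x => ∑ r ∈ s, w r * quantileInfluence (p r) (q r) (f r) x with hG
  have hGm : Measurable G :=
    Finset.measurable_fun_sum _ fun r _ => (measurable_quantileInfluence _ _ _).const_mul _
  have hIL : ∀ r, MemLp (quantileInfluence (p r) (q r) (f r)) 2 ν := fun r =>
    MemLp.of_bound (measurable_quantileInfluence _ _ _).aestronglyMeasurable
      ((|p r| + 1) / |f r|) (ae_of_all _ fun x => abs_quantileInfluence_le _ _ _ _)
  have hGL : MemLp G 2 ν := memLp_finsetSum _ fun r _ => (hIL r).const_mul _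
  have hGX : ∀ m, MemLp (fun ω => G (X m ω)) 2 P := fun m =>
    (memLp_map_measure_iff (g := G) (by rw [hlaw]; exact hGL.1) (hX m).aemeasurable).1 (by rwa [hlaw])
  have hmean : ∫ ω, G (X 0 ω) ∂P = 0 := by
    rw [← integral_map (hX 0).aemeasurable hGm.aestronglyMeasurable, hlaw, hG,
      integral_finsetSum _ fun r _ => ((hIL r).const_mul _).integrable (by norm_num)]
    refine Finset.sum_eq_zero fun r _ => ?_
    rw [integral_const_mul, integral_quantileInfluence _ (hq r), mul_zero]
  have hvar : variance (fun ω => G (X 0 ω)) P = ∑ r ∈ s, ∑ r' ∈ s,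
        w r * w r' * ((min (p r) (p r') - p r * p r') / (f r * f r')) := by
    rw [variance_of_integral_eq_zero (hGX 0).1.aemeasurable hmean,
      ← integral_map (f := fun x => G x ^ 2) (hX 0).aemeasurable
        (hGm.pow_const 2).aestronglyMeasurable, hlaw]
    have : ∀ x, G x ^ 2 = ∑ r ∈ s, ∑ r' ∈ s, w r * w r' *
        (quantileInfluence (p r) (q r) (f r) x * quantileInfluence (p r') (q r') (f r') x) := by
      intro x
      rw [hG, sq, Finset.sum_mul_sum]
      exact Finset.sum_congr rfl fun r _ => Finset.sum_congr rfl fun r' _ => by ring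
    simp_rw [this]
    have hint : ∀ r r', Integrable (fun x => w r * w r' * (quantileInfluence (p r) (q r) (f r) x *
        quantileInfluence (p r') (q r') (f r') x)) ν := fun r r' =>
      ((hIL r).integrable_mul (hIL r')).const_mul _
    rw [integral_finsetSum _ fun r _ => integrable_finsetSum _ fun r' _ => hint r r']
    refine Finset.sum_congr rfl fun r _ => ?_
    rw [integral_finsetSum _ fun r' _ => hint r r']
    refine Finset.sum_congr rfl fun r' _ => ?_
    rw [integral_const_mul, integral_quantileInfluence_mul _ _ (hq r) (hq r')]
  have hclt := tendstoInDistribution_inv_sqrt_mul_sum_sub (P := P) (X := fun m ω => G (X m ω))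
    (P' := gaussianReal 0 (variance (fun ω => G (X 0 ω)) P).toNNReal) (Y := id)
    ⟨aemeasurable_id, Measure.map_id⟩ (hGX 0)
    (hind.comp (fun _ => G) fun _ => hGm)
    (fun i => (IdentDistrib.mk (hX i).aemeasurable (hX 0).aemeasurable
      (by rw [hlaw, hlaw])).comp hGm)
  simp only [hvar, hmean, mul_zero, sub_zero] at hclt
  -- Slutsky: the weighted Bahadur remainders of finitely many quantiles vanish in probability.
  refine tendstoInDistribution_of_tendstoInMeasure_sub _ id hclt ?_ ?_
  · have := tendstoInMeasure_sum_mul s w (c := fun _ => 0) fun r _ =>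
      tendstoInMeasure_sampleQuantile_sub hX hind hlaw (hp0 r) (hp1 r) (hq r) (hf r) (hF r)
    simp only [Pi.sub_apply, mul_zero, Finset.sum_const_zero] at this
    convert! this using 1
    ext n ω
    simp only [Pi.sub_apply, hG]
    rw [Finset.sum_comm]
    simp_rw [mul_sub, Finset.sum_sub_distrib, Finset.mul_sum]
    congr 1
    · congr 1 <;> exact Finset.sum_congr rfl fun r _ => by ring
    · exact Finset.sum_congr rfl fun r _ => Finset.sum_congr rfl fun m _ => by ring
  · intro n
    refine Measurable.aemeasurable ?_
    refine Measurable.const_mul (Measurable.sub_const (Finset.measurable_fun_sum _ fun r _ =>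
      ((measurable_sampleQuantile (p r)).comp
        (measurable_pi_lambda _ fun i : Fin n => hX i)).const_mul _) _) _

/-! ### Transfer to triangular arrays -/

/-- Convergence in distribution depends only on the laws of the sequence, eventually. -/
lemma MeasureTheory.TendstoInDistribution.of_eventually_map_eq {Ω Ω₁ Ω₂ κ : Type*} [MeasurableSpace Ω]
    [MeasurableSpace Ω₁] [MeasurableSpace Ω₂] {P : Measure Ω} {P₁ : Measure Ω₁} {Q : Measure Ω₂}
    [IsProbabilityMeasure P] [IsProbabilityMeasure P₁] [IsProbabilityMeasure Q] {l : Filter κ}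
    {X : κ → Ω → ℝ} {Y : κ → Ω₁ → ℝ} {Z : Ω₂ → ℝ}
    (h : TendstoInDistribution X l Z (fun _ => P) Q) (hY : ∀ n, AEMeasurable (Y n) P₁)
    (hXY : ∀ᶠ n in l, P.map (X n) = P₁.map (Y n)) :
    TendstoInDistribution Y l Z (fun _ => P₁) Q where
  forall_aemeasurable := hY
  aemeasurable_limit := h.aemeasurable_limit
  tendsto := by
    refine h.tendsto.congr' ?_
    filter_upwards [hXY] with n hn
    exact Subtype.ext hn

/-- A group has `2 * M * n / 2 / M` members, which is only propositionally `n`. Keeping the length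
as a variable allows it to be substituted before the joint law is identified with a product measure.
-/
lemma map_comp_eq_of_fin_eq {Ω : Type*} [MeasurableSpace Ω] {P : Measure Ω}
    [IsProbabilityMeasure P] {ν : Measure ℝ} [IsProbabilityMeasure ν] {k n : ℕ} (hk : k = n)
    {T : ∀ n, (Fin n → ℝ) → ℝ} (hT : ∀ n, Measurable (T n)) {x : Fin k → Ω → ℝ}
    (hx : ∀ i, AEMeasurable (x i) P) (hind : iIndepFun x P) (hlaw : ∀ i, P.map (x i) = ν) :
    P.map (fun ω => T k fun i => x i ω) = (Measure.pi fun _ : Fin n => ν).map (T n) := by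
  subst hk
  have h := (iIndepFun_iff_map_fun_eq_pi_map hx).1 hind
  simp_rw [hlaw] at h
  rw [← h, AEMeasurable.map_map_of_aemeasurable (hT k).aemeasurable (aemeasurable_pi_lambda _ hx)]
  rfl

/-- **Asymptotic normality of the general trimean** of the rows of a triangular array whose `n`-th
row consists of `n` independent variables with law `ν`. -/
theorem tendstoInDistribution_generalTrimean {Ω : Type*} [MeasurableSpace Ω] {P : Measure Ω}
    [IsProbabilityMeasure P] {ν : Measure ℝ} [IsProbabilityMeasure ν] {k : ℕ → ℕ}
    (hk : ∀ n, k n = n) {x : ∀ n, Fin (k n) → Ω → ℝ} (hx : ∀ n i, AEMeasurable (x n i) P)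
    (hind : ∀ᶠ n in atTop, iIndepFun (x n) P) (hlaw : ∀ᶠ n in atTop, ∀ i, P.map (x n i) = ν)
    (α p : ℝ) (hp0 : 0 < p) (hp1 : p < 1) {q f : Fin 3 → ℝ}
    (hq : ∀ r, ν.real (Set.Iic (q r)) = ![p, 1 / 2, 1 - p] r) (hf : ∀ r, 0 < f r)
    (hF : ∀ r, HasDerivAt (fun x => ν.real (Set.Iic x)) (f r) (q r)) {m : ℝ} {V : ℕ → ℝ} {v : ℝ}
    (hv : 0 < v) (hm : m = ∑ r, ![α / 2, 1 - α, α / 2] r * q r)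
    (hvar : v = ∑ r, ∑ r', ![α / 2, 1 - α, α / 2] r * ![α / 2, 1 - α, α / 2] r' *
      ((min (![p, 1 / 2, 1 - p] r) (![p, 1 / 2, 1 - p] r') -
        ![p, 1 / 2, 1 - p] r * ![p, 1 / 2, 1 - p] r') / (f r * f r')))
    (hV : ∀ n : ℕ, 0 < n → V n = v / n) :
    TendstoInDistribution (fun n ω => (generalTrimean α p (fun i => x n i ω) - m) / √(V n))
      atTop (id : ℝ → ℝ) (fun _ => P) (gaussianReal 0 1) := by
  -- Rows for different `n` need not extend one another, so `Ω` may carry no single i.i.d. sequence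
  -- containing them. The limit is proved on a product space and only row laws are compared.
  set P₀ : Measure (ℕ → ℝ) := Measure.infinitePi fun _ => ν
  have hX : ∀ i, Measurable fun ω : ℕ → ℝ => ω i := measurable_pi_apply
  have hXind : iIndepFun (fun (i : ℕ) (ω : ℕ → ℝ) => ω i) P₀ :=
    iIndepFun_infinitePi (X := fun _ => id) fun _ => measurable_id
  have hXlaw : ∀ i, P₀.map (fun ω : ℕ → ℝ => ω i) = ν := fun i =>
    (measurePreserving_eval_infinitePi (fun _ => ν) i).map_eq
  have hclt := tendstoInDistribution_sum_sampleQuantile hX hXind hXlaw Finset.univ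
    ![α / 2, 1 - α, α / 2] (p := ![p, 1 / 2, 1 - p]) (q := q) (f := f)
    (by intro r; fin_cases r <;> simp [hp0, hp1]) (by intro r; fin_cases r <;> norm_num [hp0, hp1])
    hq hf hF
  rw [← hvar, ← hm] at hclt
  have hclt' := hclt.continuous_comp (g := fun y => y / √v) (by fun_prop)
  have hlim : TendstoInDistribution
      (fun n (ω : ℕ → ℝ) => (generalTrimean α p (fun i : Fin n => ω i) - m) / √(v / n)) atTop
      (fun y : ℝ => y / √v) (fun _ => P₀) (gaussianReal 0 v.toNNReal) := by
    refine hclt'.congr (fun n => ae_of_all _ fun ω => ?_) (ae_of_all _ fun y => rfl)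
    simp only [Function.comp_apply, Fin.sum_univ_three, Matrix.cons_val, generalTrimean]
    rw [Real.sqrt_div hv.le]
    rcases Nat.eq_zero_or_pos n with rfl | hn
    · simp
    · have : 0 < √(n : ℝ) := Real.sqrt_pos.2 (by exact_mod_cast hn)
      field_simp
  have hlim1 : TendstoInDistribution
      (fun n (ω : ℕ → ℝ) => (generalTrimean α p (fun i : Fin n => ω i) - m) / √(v / n)) atTop
      (id : ℝ → ℝ) (fun _ => P₀) (gaussianReal 0 1) := by
    refine ⟨hlim.forall_aemeasurable, aemeasurable_id, ?_⟩
    convert! hlim.tendsto using 2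
    congr 1
    refine Subtype.ext ?_
    change Measure.map id _ = Measure.map (fun y => y / √v) _
    rw [Measure.map_id, gaussianReal_map_div_const]
    congr 1
    · simp
    · have : v.toNNReal ≠ 0 := by simpa using hv
      ext
      simp [Real.sq_sqrt hv.le, hv.le, hv.ne']
  refine hlim1.of_eventually_map_eq (fun n => ?_) ?_
  · exact (((measurable_generalTrimean α p).comp_aemeasurable
      (aemeasurable_pi_lambda _ (hx n))).sub_const _).div_const _
  · filter_upwards [hind, hlaw, eventually_gt_atTop 0] with n h1 h2 hn
    rw [hV n hn]
    have hT : ∀ j, Measurable fun y : Fin j → ℝ => (generalTrimean α p y - m) / √(v / n) :=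
      fun j => ((measurable_generalTrimean α p).sub_const _).div_const _
    rw [map_comp_eq_of_fin_eq (hk n) hT (hx n) h1 h2]
    exact map_comp_eq_of_fin_eq rfl hT (x := fun (i : Fin n) (ω : ℕ → ℝ) => ω i)
      (fun i => (hX i).aemeasurable) (hXind.precomp Fin.val_injective) (fun i => hXlaw i)

/-! ### The law of a logged mid-energy -/

lemma lintegral_Ioi_rayleigh {v y : ℝ} (hv : 0 < v) (hy : 0 ≤ y) :
    ∫⁻ r in Set.Ioi √(2 * y), ENNReal.ofReal (r / v * Real.exp (-(r ^ 2) / (2 * v))) =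
      ENNReal.ofReal (Real.exp (-y / v)) := by
  have hd : ∀ r ∈ Set.Ici √(2 * y), HasDerivAt (fun r : ℝ => -Real.exp (-(r ^ 2) / (2 * v)))
      (r / v * Real.exp (-(r ^ 2) / (2 * v))) r := by
    intro r _
    have h1 : HasDerivAt (fun r : ℝ => -(r ^ 2) / (2 * v)) (-(2 * r) / (2 * v)) r := by
      simpa using ((hasDerivAt_pow 2 r).neg).div_const (2 * v)
    convert! h1.exp.neg using 1
    field_simp
  have hpos : ∀ r ∈ Set.Ioi √(2 * y), 0 ≤ r / v * Real.exp (-(r ^ 2) / (2 * v)) := by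
    intro r hr
    have : 0 < r := (Real.sqrt_nonneg _).trans_lt hr
    positivity
  have hlim : Tendsto (fun r : ℝ => -Real.exp (-(r ^ 2) / (2 * v))) atTop (𝓝 0) := by
    rw [← neg_zero]
    refine (Real.tendsto_exp_atBot.comp ?_).neg
    have : Tendsto (fun r : ℝ => r ^ 2 / (2 * v)) atTop atTop :=
      (tendsto_pow_atTop two_ne_zero).atTop_div_const (by positivity)
    simp only [neg_div]
    exact tendsto_neg_atTop_atBot.comp this
  rw [← ofReal_integral_eq_lintegral_ofReal (integrableOn_Ioi_deriv_of_nonneg' hd hpos hlim)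
    (ae_restrict_of_forall_mem measurableSet_Ioi hpos),
    integral_Ioi_of_hasDerivAt_of_nonneg' hd hpos hlim, Real.sq_sqrt (by positivity)]
  congr 1
  rw [zero_sub, neg_neg]
  congr 1
  field_simp

/-- The mean of the squares of two independent centred Gaussians of variance `v` is exponential of
mean `v`. -/
lemma prod_gaussianReal_half_sq_add_sq_gt {v : ℝ≥0} (hv : v ≠ 0) {y : ℝ} (hy : 0 ≤ y) :
    ((gaussianReal 0 v).prod (gaussianReal 0 v)) {z | y < (z.1 ^ 2 + z.2 ^ 2) / 2} =
      ENNReal.ofReal (Real.exp (-y / v)) := by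
  have hv' : (0 : ℝ) < v := by positivity
  have hS : MeasurableSet {z : ℝ × ℝ | y < (z.1 ^ 2 + z.2 ^ 2) / 2} :=
    measurableSet_lt measurable_const (by fun_prop)
  rw [gaussianReal_of_var_ne_zero _ hv, prod_withDensity (measurable_gaussianPDF _ _)
    (measurable_gaussianPDF _ _), withDensity_apply _ hS, ← lintegral_indicator hS,
    ← Measure.volume_eq_prod, ← lintegral_comp_polarCoord_symm]
  -- In polar coordinates the integrand splits into the Rayleigh density of the radius and the
  -- constant angular density `1 / (2π)`.
  have hpt : ∀ p ∈ polarCoord.target, ENNReal.ofReal p.1 •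
      {z : ℝ × ℝ | y < (z.1 ^ 2 + z.2 ^ 2) / 2}.indicator
        (fun z => gaussianPDF 0 v z.1 * gaussianPDF 0 v z.2) (polarCoord.symm p) =
      (Set.Ioi √(2 * y)).indicator
        (fun r => ENNReal.ofReal (r / v * Real.exp (-(r ^ 2) / (2 * v)))) p.1 *
        ENNReal.ofReal (1 / (2 * Real.pi)) := by
    rintro ⟨r, θ⟩ hp
    have hr : 0 < r := hp.1
    have hsum : (r * Real.cos θ) ^ 2 + (r * Real.sin θ) ^ 2 = r ^ 2 := by
      have := Real.sin_sq_add_cos_sq θ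
      linear_combination r ^ 2 * this
    simp only [polarCoord_symm_apply]
    have hmem : ((r * Real.cos θ, r * Real.sin θ) ∈
        {z : ℝ × ℝ | y < (z.1 ^ 2 + z.2 ^ 2) / 2}) ↔ r ∈ Set.Ioi √(2 * y) := by
      simp only [Set.mem_ofPred_eq, Set.mem_Ioi, hsum]
      rw [Real.sqrt_lt' hr]
      constructor <;> intro h <;> linarith
    by_cases h : r ∈ Set.Ioi √(2 * y)
    · rw [Set.indicator_of_mem (hmem.2 h), Set.indicator_of_mem h]
      simp only [gaussianPDF, gaussianPDFReal, sub_zero, smul_eq_mul]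
      rw [← ENNReal.ofReal_mul (by positivity), ← ENNReal.ofReal_mul (by positivity),
        ← ENNReal.ofReal_mul (by positivity)]
      congr 1
      have h2 : (√(2 * Real.pi * v))⁻¹ * (√(2 * Real.pi * v))⁻¹ = (2 * Real.pi * v)⁻¹ := by
        rw [← mul_inv, Real.mul_self_sqrt (by positivity)]
      calc r * ((√(2 * Real.pi * v))⁻¹ * Real.exp (-(r * Real.cos θ) ^ 2 / (2 * v)) *
            ((√(2 * Real.pi * v))⁻¹ * Real.exp (-(r * Real.sin θ) ^ 2 / (2 * v))))
          = r * ((√(2 * Real.pi * v))⁻¹ * (√(2 * Real.pi * v))⁻¹) *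
            (Real.exp (-(r * Real.cos θ) ^ 2 / (2 * v)) *
              Real.exp (-(r * Real.sin θ) ^ 2 / (2 * v))) := by ring
        _ = r * (2 * Real.pi * v)⁻¹ * Real.exp (-(r ^ 2) / (2 * v)) := by
            rw [h2, ← Real.exp_add, ← add_div, ← neg_add, hsum]
        _ = _ := by field_simp
    · rw [Set.indicator_of_notMem (fun h' => h (hmem.1 h')), Set.indicator_of_notMem h]
      simp
  rw [setLIntegral_congr_fun polarCoord.open_target.measurableSet hpt, polarCoord_target,
    Measure.volume_eq_prod, ← Measure.prod_restrict,
    lintegral_prod_mul (f := (Set.Ioi √(2 * y)).indicator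
        (fun r => ENNReal.ofReal (r / v * Real.exp (-(r ^ 2) / (2 * v)))))
      (g := fun _ => ENNReal.ofReal (1 / (2 * Real.pi)))
      (Measurable.indicator (by fun_prop) measurableSet_Ioi).aemeasurable aemeasurable_const,
    lintegral_indicator measurableSet_Ioi, Measure.restrict_restrict measurableSet_Ioi,
    Set.inter_eq_self_of_subset_left (Set.Ioi_subset_Ioi (Real.sqrt_nonneg _)),
    lintegral_Ioi_rayleigh hv' hy]
  simp only [lintegral_const, MeasurableSet.univ, Measure.restrict_apply, Set.univ_inter,
    Real.volume_Ioo]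
  rw [← ENNReal.ofReal_mul (by positivity)]
  have : 1 / (2 * Real.pi) * (Real.pi - -Real.pi) = 1 := by
    field_simp
    ring
  rw [this, ENNReal.ofReal_one, mul_one]

/-- The law of the logarithm of the mean of the squares of two independent centred Gaussians of
variance `v`. -/
noncomputable def logEnergyLaw (v : ℝ≥0) : Measure ℝ :=
  ((gaussianReal 0 v).prod (gaussianReal 0 v)).map fun z => Real.log ((z.1 ^ 2 + z.2 ^ 2) / 2)

lemma measurable_log_half_sq_add_sq :
    Measurable fun z : ℝ × ℝ => Real.log ((z.1 ^ 2 + z.2 ^ 2) / 2) :=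
  Real.measurable_log.comp (by fun_prop)

instance (v : ℝ≥0) : IsProbabilityMeasure (logEnergyLaw v) :=
  Measure.isProbabilityMeasure_map measurable_log_half_sq_add_sq.aemeasurable

lemma logEnergyLaw_real_Iic {v : ℝ≥0} (hv : v ≠ 0) (x : ℝ) :
    (logEnergyLaw v).real (Set.Iic x) = 1 - Real.exp (-Real.exp x / v) := by
  set γ := (gaussianReal 0 v).prod (gaussianReal 0 v) with hγ
  -- The convention `Real.log 0 = 0` would break `log y ≤ x ↔ y ≤ exp x`; the tail formula at `0`
  -- shows that the value `0` is null.
  have hpos : ∀ᵐ z ∂γ, 0 < (z.1 ^ 2 + z.2 ^ 2) / 2 := by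
    have h0 := prod_gaussianReal_half_sq_add_sq_gt hv le_rfl
    simp only [neg_zero, zero_div, Real.exp_zero, ENNReal.ofReal_one] at h0
    exact (prob_compl_eq_zero_iff (measurableSet_lt measurable_const (by fun_prop))).2 h0
  have hset : (fun z : ℝ × ℝ => Real.log ((z.1 ^ 2 + z.2 ^ 2) / 2)) ⁻¹' Set.Iic x =ᵐ[γ]
      ({z : ℝ × ℝ | Real.exp x < (z.1 ^ 2 + z.2 ^ 2) / 2}ᶜ : Set (ℝ × ℝ)) := by
    filter_upwards [hpos] with z hz
    refine propext ?_
    change Real.log ((z.1 ^ 2 + z.2 ^ 2) / 2) ≤ x ↔ ¬ (Real.exp x < (z.1 ^ 2 + z.2 ^ 2) / 2)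
    rw [Real.log_le_iff_le_exp hz, not_lt]
  rw [Measure.real, logEnergyLaw, Measure.map_apply measurable_log_half_sq_add_sq
    measurableSet_Iic, measure_congr hset, ← Measure.real,
    probReal_compl_eq_one_sub (measurableSet_lt measurable_const (by fun_prop)), Measure.real,
    prod_gaussianReal_half_sq_add_sq_gt hv (Real.exp_pos x).le,
    ENNReal.toReal_ofReal (Real.exp_pos _).le]

/-- The `p`-quantile of `logEnergyLaw v`. -/
noncomputable def logEnergyQuantile (v : ℝ≥0) (p : ℝ) : ℝ := Real.log (v * -Real.log (1 - p))

lemma logEnergyLaw_real_Iic_quantile {v : ℝ≥0} (hv : v ≠ 0) {p : ℝ} (hp0 : 0 < p) (hp1 : p < 1) :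
    (logEnergyLaw v).real (Set.Iic (logEnergyQuantile v p)) = p := by
  have hv' : (0 : ℝ) < v := by positivity
  have hl : 0 < -Real.log (1 - p) := neg_pos.2 (Real.log_neg (by linarith) (by linarith))
  rw [logEnergyLaw_real_Iic hv, logEnergyQuantile, Real.exp_log (by positivity), neg_div,
    mul_div_cancel_left₀ _ hv'.ne', neg_neg, Real.exp_log (by linarith)]
  ring

/-- The derivative is `(e^x / v) exp(-e^x / v)`, and `e^x / v = -log(1 - p)` at the quantile. So `v`
cancels, which makes the asymptotic variances independent of the level. -/
lemma hasDerivAt_logEnergyLaw_real_Iic {v : ℝ≥0} (hv : v ≠ 0) {p : ℝ} (hp0 : 0 < p)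
    (hp1 : p < 1) : HasDerivAt (fun x => (logEnergyLaw v).real (Set.Iic x))
      (-((1 - p) * Real.log (1 - p))) (logEnergyQuantile v p) := by
  have hv' : (0 : ℝ) < v := by positivity
  have hl : 0 < -Real.log (1 - p) := neg_pos.2 (Real.log_neg (by linarith) (by linarith))
  simp_rw [logEnergyLaw_real_Iic hv]
  have h := (((Real.hasDerivAt_exp (logEnergyQuantile v p)).neg.div_const (v : ℝ)).exp).const_sub 1
  convert! h using 1
  rw [Pi.neg_apply, logEnergyQuantile, Real.exp_log (by positivity), neg_div,
    mul_div_cancel_left₀ _ hv'.ne', neg_neg, Real.exp_log (by linarith)]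

/-- The logarithm of the mean of the squares of two independent centred Gaussian variables. -/
lemma map_log_half_sq_add_sq {Ω : Type*} [MeasurableSpace Ω] {P : Measure Ω}
    [IsProbabilityMeasure P] {X Y : Ω → ℝ} {v : ℝ≥0} (hX : AEMeasurable X P)
    (hY : AEMeasurable Y P) (hXl : P.map X = gaussianReal 0 v) (hYl : P.map Y = gaussianReal 0 v)
    (hind : IndepFun X Y P) :
    P.map (fun ω => Real.log ((X ω ^ 2 + Y ω ^ 2) / 2)) = logEnergyLaw v := by
  rw [logEnergyLaw, ← hXl]
  nth_rw 2 [hXl]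
  rw [← hYl, ← (indepFun_iff_map_prod_eq_prod_map_map hX hY).1 hind,
    AEMeasurable.map_map_of_aemeasurable measurable_log_half_sq_add_sq.aemeasurable
      (hX.prodMk hY)]
  rfl

/-! ### Gaussian integrals of continuous paths -/

/-- An almost sure limit of centred Gaussian variables is centred Gaussian, and the variances
converge. -/
lemma exists_tendsto_var_of_ae_tendsto {Ω : Type*} [MeasurableSpace Ω] {P : Measure Ω}
    [IsProbabilityMeasure P] {X : ℕ → Ω → ℝ} {Y : Ω → ℝ} {v : ℕ → ℝ≥0}
    (hX : ∀ n, AEMeasurable (X n) P) (hlaw : ∀ n, P.map (X n) = gaussianReal 0 (v n))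
    (hlim : ∀ᵐ ω ∂P, Tendsto (fun n => X n ω) atTop (𝓝 (Y ω))) :
    ∃ w, Tendsto v atTop (𝓝 w) ∧ AEMeasurable Y P ∧ P.map Y = gaussianReal 0 w := by
  have hY : AEMeasurable Y P := aemeasurable_of_tendsto_metrizable_ae' hX hlim
  have : IsProbabilityMeasure (P.map Y) := Measure.isProbabilityMeasure_map hY
  have hchar : ∀ u : ℝ, Tendsto (fun n => Complex.exp (-(v n * u ^ 2 / 2))) atTop
      (𝓝 (charFun (P.map Y) u)) := by
    intro u
    have h := ProbabilityMeasure.tendsto_iff_tendsto_charFun.1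
      (tendstoInDistribution_of_ae_tendsto hX hY hlim).tendsto u
    refine h.congr fun n => ?_
    change charFun (P.map (X n)) u = _
    rw [hlaw, charFun_gaussianReal]
    simp
  have hnorm : ∀ u : ℝ, Tendsto (fun n => Real.exp (-(v n * u ^ 2 / 2))) atTop
      (𝓝 ‖charFun (P.map Y) u‖) := by
    intro u
    refine (hchar u).norm.congr fun n => ?_
    rw [Complex.norm_exp]
    norm_cast
  -- The limiting characteristic function is continuous and non-zero at `0`, hence non-zero at some
  -- `u ≠ 0`, where the variance can be read off from its modulus.
  obtain ⟨u, hu0, hu⟩ : ∃ u : ℝ, u ≠ 0 ∧ charFun (P.map Y) u ≠ 0 := by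
    have h0 : charFun (P.map Y) 0 ≠ 0 := by simp
    have h1 := (continuous_charFun (μ := P.map Y)).continuousAt.eventually_ne h0
    have h2 : ∀ᶠ u in 𝓝[≠] (0 : ℝ), charFun (P.map Y) u ≠ 0 := h1.filter_mono nhdsWithin_le_nhds
    obtain ⟨u, h⟩ := (h2.and self_mem_nhdsWithin).exists
    exact ⟨u, h.2, h.1⟩
  have hv : Tendsto (fun n => (v n : ℝ)) atTop
      (𝓝 (-(2 / u ^ 2) * Real.log ‖charFun (P.map Y) u‖)) := by
    have := ((hnorm u).log (norm_ne_zero_iff.2 hu)).const_mul (-(2 / u ^ 2))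
    refine this.congr fun n => ?_
    rw [Real.log_exp]
    field_simp
  have hw0 : 0 ≤ -(2 / u ^ 2) * Real.log ‖charFun (P.map Y) u‖ :=
    ge_of_tendsto' hv fun n => (v n).2
  obtain ⟨w, hw⟩ : ∃ w : ℝ≥0, (w : ℝ) = -(2 / u ^ 2) * Real.log ‖charFun (P.map Y) u‖ :=
    ⟨⟨_, hw0⟩, rfl⟩
  rw [← hw] at hv
  refine ⟨w, NNReal.tendsto_coe.1 hv, hY, Measure.ext_of_charFun (funext fun s => ?_)⟩
  refine tendsto_nhds_unique (hchar s) ?_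
  rw [charFun_gaussianReal]
  have h := (((Complex.continuous_ofReal.tendsto _).comp hv).mul_const ((s : ℂ) ^ 2)).div_const 2
  have h' := (Complex.continuous_exp.tendsto _).comp h.neg
  convert! h' using 2
  simp

/-- The integral of `ψ` over the `k`-th cell of the grid of mesh `1 / (n + 1)`. -/
noncomputable def cellIntegral (ψ : ℝ → ℝ) (n : ℕ) (k : ℤ) : ℝ :=
  ∫ t, {t : ℝ | ⌊((n : ℝ) + 1) * t⌋ = k}.indicator ψ t

lemma measurableSet_cell (n : ℕ) (k : ℤ) :
    MeasurableSet {t : ℝ | ⌊((n : ℝ) + 1) * t⌋ = k} := by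
  have h : Measurable fun t : ℝ => ⌊((n : ℝ) + 1) * t⌋ :=
    Int.measurable_floor.comp (measurable_const.mul measurable_id)
  exact h (measurableSet_singleton k)

lemma abs_floor_div_sub_le (n : ℕ) (t : ℝ) :
    |(⌊((n : ℝ) + 1) * t⌋ : ℝ) / (n + 1) - t| ≤ 1 / (n + 1) := by
  have hn : (0 : ℝ) < n + 1 := by positivity
  have h1 := Int.floor_le (((n : ℝ) + 1) * t)
  have h2 := Int.lt_floor_add_one (((n : ℝ) + 1) * t)
  rw [div_sub' hn.ne', abs_div, abs_of_pos hn]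
  gcongr
  rw [abs_le]
  constructor <;> linarith

lemma tendsto_floor_div (t : ℝ) :
    Tendsto (fun n : ℕ => (⌊((n : ℝ) + 1) * t⌋ : ℝ) / (n + 1)) atTop (𝓝 t) := by
  rw [tendsto_iff_dist_tendsto_zero]
  refine squeeze_zero (fun _ => dist_nonneg) (fun n => abs_floor_div_sub_le n t)
    tendsto_one_div_add_atTop_nhds_zero_nat

/-- The grid points of mesh `1 / (n + 1)` that meet `[-R, R]`. -/
noncomputable def gridIndices (R n : ℕ) : Finset ℤ :=
  Finset.Icc (-((R + 1) * (n + 1) : ℤ)) ((R + 1) * (n + 1))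

lemma floor_mem_gridIndices {R n : ℕ} {t : ℝ} (ht : |t| ≤ R) :
    ⌊((n : ℝ) + 1) * t⌋ ∈ gridIndices R n := by
  have hn : (0 : ℝ) < n + 1 := by positivity
  obtain ⟨h1, h2⟩ := abs_le.1 ht
  rw [gridIndices, Finset.mem_Icc]
  constructor
  · rw [Int.le_floor]
    push_cast
    nlinarith
  · have : (⌊((n : ℝ) + 1) * t⌋ : ℝ) ≤ (R + 1) * (n + 1) := by
      refine (Int.floor_le _).trans ?_
      nlinarith
    exact_mod_cast this

lemma sum_cellIntegral_mul {ψ : ℝ → ℝ} (hψ : Integrable ψ) {R : ℕ}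
    (hsupp : ∀ t, (R : ℝ) < |t| → ψ t = 0) (g : ℝ → ℝ) (n : ℕ) :
    ∑ k ∈ gridIndices R n, cellIntegral ψ n k * g ((k : ℝ) / (n + 1)) =
      ∫ t, g ((⌊((n : ℝ) + 1) * t⌋ : ℝ) / (n + 1)) * ψ t := by
  simp only [cellIntegral, ← integral_mul_const]
  rw [← integral_finsetSum _ fun k _ =>
    (hψ.indicator (measurableSet_cell n k)).mul_const _]
  congr with t
  by_cases ht : (R : ℝ) < |t|
  · simp [Set.indicator_apply, hsupp t ht]
  · rw [Finset.sum_eq_single_of_mem _ (floor_mem_gridIndices (not_lt.1 ht)) fun k _ hk => ?_]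
    · simp [mul_comm]
    · rw [Set.indicator_of_notMem (fun h => hk h.symm), zero_mul]

/-- Riemann sums of a continuous function against a compactly supported integrable weight. -/
lemma tendsto_sum_cellIntegral_mul {ψ : ℝ → ℝ} (hψ : Integrable ψ) {R : ℕ}
    (hsupp : ∀ t, (R : ℝ) < |t| → ψ t = 0) {g : ℝ → ℝ} (hg : Continuous g) :
    Tendsto (fun n : ℕ => ∑ k ∈ gridIndices R n, cellIntegral ψ n k * g ((k : ℝ) / (n + 1))) atTop
      (𝓝 (∫ t, g t * ψ t)) := by
  simp_rw [sum_cellIntegral_mul hψ hsupp g]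
  -- The margin `1` is needed because rounding moves a point of `[-R, R]` by up to one mesh width,
  -- which is at most `1`.
  obtain ⟨C, hC⟩ := (isCompact_Icc (a := -((R : ℝ) + 1)) (b := R + 1)).exists_bound_of_continuousOn
    hg.continuousOn
  refine tendsto_integral_of_dominated_convergence (fun t => C * |ψ t|) (fun n => ?_)
    (hψ.abs.const_mul C) (fun n => ae_of_all _ fun t => ?_) (ae_of_all _ fun t => ?_)
  · have : Measurable fun t : ℝ => g ((⌊((n : ℝ) + 1) * t⌋ : ℝ) / (n + 1)) := by
      have h : Measurable fun t : ℝ => ⌊((n : ℝ) + 1) * t⌋ :=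
        Int.measurable_floor.comp (measurable_const.mul measurable_id)
      exact hg.measurable.comp ((measurable_from_top.comp h).div_const _)
    exact this.aestronglyMeasurable.mul hψ.1
  · by_cases ht : (R : ℝ) < |t|
    · simp [hsupp t ht]
    · rw [norm_mul, Real.norm_eq_abs (ψ t)]
      refine mul_le_mul_of_nonneg_right (hC _ ?_) (abs_nonneg _)
      have h1 := abs_floor_div_sub_le n t
      have h2 : 1 / ((n : ℝ) + 1) ≤ 1 := by
        rw [div_le_one (by positivity)]
        linarith [(Nat.cast_nonneg n : (0 : ℝ) ≤ n)]
      obtain ⟨h3, h4⟩ := abs_le.1 (h1.trans h2)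
      obtain ⟨h5, h6⟩ := abs_le.1 (not_lt.1 ht)
      constructor <;> linarith
  · exact ((hg.tendsto t).comp (tendsto_floor_div t)).mul_const _

/-- The variance of the Riemann sum of a process with covariance function `K` against `ψ`. -/
noncomputable def gridVariance (K : ℝ → ℝ → ℝ) (ψ : ℝ → ℝ) (R n : ℕ) : ℝ :=
  ∑ k ∈ gridIndices R n, ∑ l ∈ gridIndices R n, cellIntegral ψ n l * (cellIntegral ψ n k *
    K ((k : ℝ) / (n + 1)) ((l : ℝ) / (n + 1)))

lemma lintegral_enorm_floor_div_le {Ω : Type*} [MeasurableSpace Ω] {P : Measure Ω}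
    {G : ℝ → Ω → ℝ} (hGi : ∀ t, Integrable (G t) P) {C : ℝ} (hC0 : 0 ≤ C)
    (hC : ∀ t, ∫ ω, |G t ω| ∂P ≤ C * (1 + |t|)) (n : ℕ) (t : ℝ) :
    ∫⁻ ω, ‖G ((⌊((n : ℝ) + 1) * t⌋ : ℝ) / (n + 1)) ω‖ₑ ∂P ≤
      ENNReal.ofReal (2 * C * (1 + |t|)) := by
  rw [← ofReal_integral_norm_eq_lintegral_enorm (hGi _)]
  refine ENNReal.ofReal_le_ofReal ((hC _).trans ?_)
  have h1 := abs_floor_div_sub_le n t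
  generalize (⌊((n : ℝ) + 1) * t⌋ : ℝ) / (n + 1) = q at h1 ⊢
  have h2 : 1 / ((n : ℝ) + 1) ≤ 1 := by
    rw [div_le_one (by positivity)]
    linarith [(Nat.cast_nonneg n : (0 : ℝ) ≤ n)]
  have h3 : |q| ≤ |t| + 1 := by
    calc |q| = |t + (q - t)| := by ring_nf
      _ ≤ |t| + |q - t| := abs_add_le _ _
      _ ≤ |t| + 1 := by linarith
  nlinarith [abs_nonneg t]

section GaussianIntegral

variable {Ω : Type*} [MeasurableSpace Ω] {P : Measure Ω} [IsProbabilityMeasure P]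
  {G : ℝ → Ω → ℝ}

/-- Finite combinations of a Gaussian process are Gaussian. The variance involves the process only
through its covariance function, which is what later permits comparing two processes. -/
lemma map_sum_cellIntegral_mul (hG : IsGaussianProcess G P) (h0 : ∀ t, ∫ ω, G t ω ∂P = 0)
    (ψ : ℝ → ℝ) (R n : ℕ) :
    P.map (fun ω => ∑ k ∈ gridIndices R n, cellIntegral ψ n k * G ((k : ℝ) / (n + 1)) ω) =
      gaussianReal 0
        (gridVariance (fun s t => covariance (G s) (G t) P) ψ R n).toNNReal := by
  have hlaw : HasGaussianLaw
      (fun ω => ∑ k ∈ gridIndices R n, cellIntegral ψ n k * G ((k : ℝ) / (n + 1)) ω) P := by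
    have := ((hG.comp_right fun k : ℤ => (k : ℝ) / (n + 1)).smul
      (cellIntegral ψ n)).hasGaussianLaw_fun_sum (I := gridIndices R n)
    simpa using this
  have hL : ∀ t, MemLp (G t) 2 P := fun t => (hG.hasGaussianLaw_eval t).memLp_two
  rw [hlaw.map_eq_gaussianReal]
  congr 1
  · rw [integral_finsetSum _ fun k _ => ((hL _).integrable (by norm_num)).const_mul _]
    simp [integral_const_mul, h0]
  · rw [variance_fun_sum' fun k _ => (hL _).const_mul _]
    simp only [gridVariance, covariance_const_mul_left, covariance_const_mul_right]

lemma exists_law_integral_of_compact_support (hG : IsGaussianProcess G P)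
    (h0 : ∀ t, ∫ ω, G t ω ∂P = 0) (hc : ∀ᵐ ω ∂P, Continuous fun t => G t ω) {ψ : ℝ → ℝ}
    (hψ : Integrable ψ) {R : ℕ} (hsupp : ∀ t, (R : ℝ) < |t| → ψ t = 0) :
    ∃ w, Tendsto (fun n => (gridVariance (fun s t => covariance (G s) (G t) P) ψ R n).toNNReal)
        atTop (𝓝 w) ∧ AEMeasurable (fun ω => ∫ t, G t ω * ψ t) P ∧
      P.map (fun ω => ∫ t, G t ω * ψ t) = gaussianReal 0 w := by
  refine exists_tendsto_var_of_ae_tendsto (fun n => ?_) (map_sum_cellIntegral_mul hG h0 ψ R) ?_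
  · exact Finset.aemeasurable_fun_sum _ fun k _ => (hG.aemeasurable _).const_mul _
  · filter_upwards [hc] with ω hω using tendsto_sum_cellIntegral_mul hψ hsupp hω

/-- Truncate `ψ` to `[-R, R]` and let `R` grow, with `|G ψ|` as dominating function. Recording the
variance as an iterated limit of `gridVariance` keeps its dependence on the covariance explicit. -/
lemma exists_law_integral (hG : IsGaussianProcess G P)
    (h0 : ∀ t, ∫ ω, G t ω ∂P = 0) (hc : ∀ᵐ ω ∂P, Continuous fun t => G t ω) {ψ : ℝ → ℝ}
    (hψ : Integrable ψ) (hint : ∀ᵐ ω ∂P, Integrable fun t => G t ω * ψ t) :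
    ∃ (w : ℕ → ℝ≥0) (v : ℝ≥0), (∀ R : ℕ, Tendsto (fun n =>
        (gridVariance (fun s t => covariance (G s) (G t) P)
          ((Set.Icc (-(R : ℝ)) R).indicator ψ) R n).toNNReal) atTop (𝓝 (w R))) ∧
      Tendsto w atTop (𝓝 v) ∧ AEMeasurable (fun ω => ∫ t, G t ω * ψ t) P ∧
      P.map (fun ω => ∫ t, G t ω * ψ t) = gaussianReal 0 v := by
  have hR : ∀ R : ℕ, ∃ w, Tendsto (fun n =>
        (gridVariance (fun s t => covariance (G s) (G t) P)
          ((Set.Icc (-(R : ℝ)) R).indicator ψ) R n).toNNReal) atTop (𝓝 w) ∧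
      AEMeasurable (fun ω => ∫ t, G t ω * (Set.Icc (-(R : ℝ)) R).indicator ψ t) P ∧
      P.map (fun ω => ∫ t, G t ω * (Set.Icc (-(R : ℝ)) R).indicator ψ t) = gaussianReal 0 w :=
    fun R => exists_law_integral_of_compact_support hG h0 hc (hψ.indicator measurableSet_Icc)
      fun t ht => Set.indicator_of_notMem
        (fun h : t ∈ Set.Icc (-(R : ℝ)) R => (not_lt.2 (abs_le.2 h)) ht) _
  choose w hw1 hw2 hw3 using hR
  obtain ⟨v, hv1, hv2, hv3⟩ := exists_tendsto_var_of_ae_tendsto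
    (Y := fun ω => ∫ t, G t ω * ψ t) hw2 hw3 (by
      filter_upwards [hint] with ω hω
      refine tendsto_integral_of_dominated_convergence (fun t => ‖G t ω * ψ t‖) (fun R => ?_)
        hω.norm (fun R => ae_of_all _ fun t => ?_) (ae_of_all _ fun t => ?_)
      · have := (hω.indicator (measurableSet_Icc (a := -(R : ℝ)) (b := R))).1
        refine this.congr (ae_of_all _ fun t => ?_)
        exact Set.indicator_mul_right _ (fun t => G t ω) ψ
      · by_cases h : t ∈ Set.Icc (-(R : ℝ)) R
        · simp [h]
        · rw [Set.indicator_of_notMem h]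
          simp
          positivity
      · obtain ⟨N, hN⟩ := exists_nat_ge |t|
        refine tendsto_const_nhds.congr' ?_
        filter_upwards [eventually_ge_atTop N] with R hRN
        rw [Set.indicator_of_mem]
        exact abs_le.1 (hN.trans (by exact_mod_cast hRN)))
  exact ⟨w, v, hw1, hv1, hv2, hv3⟩

/-- Almost every path of a process with linearly growing mean absolute value is integrable against
a weight with finite first moment. -/
lemma ae_integrable_path (hcont : ∀ᵐ ω ∂P, Continuous fun t => G t ω)
    (hGi : ∀ t, Integrable (G t) P) {C : ℝ} (hC : ∀ t, ∫ ω, |G t ω| ∂P ≤ C * (1 + |t|))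
    {ψ : ℝ → ℝ} (hψ : Integrable ψ) (hψw : Integrable fun t => (1 + |t|) * ψ t) :
    ∀ᵐ ω ∂P, Integrable fun t => G t ω * ψ t := by
  have hC0 : 0 ≤ C := by
    have := (integral_nonneg fun ω => abs_nonneg (G 0 ω)).trans (hC 0)
    simpa using this
  have hGm : ∀ t, AEMeasurable (G t) P := fun t => (hGi t).aemeasurable
  -- `G` is not assumed jointly measurable. Rounding time to a countable grid and taking measurable
  -- versions there gives a jointly measurable `D`, for which Tonelli bounds the mean; Fatou and
  -- path continuity then recover `G`.
  choose A hAm hAe using hGm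
  obtain ⟨φ, hφm, hφψ⟩ := hψ.aemeasurable
  obtain ⟨D, hD⟩ : ∃ D : ℕ → ℝ → Ω → ℝ,
      ∀ n t ω, D n t ω = A ((⌊((n : ℝ) + 1) * t⌋ : ℝ) / (n + 1)) ω := ⟨_, fun _ _ _ => rfl⟩
  have hDm : ∀ n, Measurable fun z : ℝ × Ω => D n z.1 z.2 := by
    intro n
    have h1 : Measurable fun z : ℤ × Ω => A ((z.1 : ℝ) / (n + 1)) z.2 :=
      measurable_from_prod_countable_right fun k => hAm ((k : ℝ) / (n + 1))
    have h2 : Measurable fun z : ℝ × Ω => (⌊((n : ℝ) + 1) * z.1⌋, z.2) :=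
      (Int.measurable_floor.comp (measurable_const.mul measurable_fst)).prodMk measurable_snd
    simp only [hD]
    exact h1.comp h2
  have hDφ : ∀ n, Measurable fun z : Ω × ℝ => ‖D n z.2 z.1 * φ z.2‖ₑ := fun n =>
    (((hDm n).comp measurable_swap).mul (hφm.comp measurable_snd)).enorm
  obtain ⟨J, hJ⟩ : ∃ J : ℕ → Ω → ℝ≥0∞, ∀ n ω, J n ω = ∫⁻ t, ‖D n t ω * φ t‖ₑ :=
    ⟨_, fun _ _ => rfl⟩
  have hJm : ∀ n, Measurable (J n) := fun n => by
    rw [funext (hJ n)]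
    exact (hDφ n).lintegral_prod_right'
  obtain ⟨K, hK⟩ : ∃ K : ℝ≥0∞, K = ENNReal.ofReal (2 * C) * ∫⁻ t, ‖(1 + |t|) * ψ t‖ₑ := ⟨_, rfl⟩
  have hKtop : K < ∞ := hK ▸ ENNReal.mul_lt_top ENNReal.ofReal_lt_top hψw.2
  have hJK : ∀ n, ∫⁻ ω, J n ω ∂P ≤ K := by
    intro n
    simp only [hJ]
    rw [lintegral_lintegral_swap (hDφ n).aemeasurable, hK,
      ← lintegral_const_mul' _ _ ENNReal.ofReal_ne_top]
    refine lintegral_mono_ae ?_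
    filter_upwards [hφψ] with t ht
    simp only [enorm_mul]
    rw [lintegral_mul_const' _ _ enorm_ne_top, ← ht, ← mul_assoc]
    refine mul_le_mul_left ?_ _
    calc ∫⁻ ω, ‖D n t ω‖ₑ ∂P = ∫⁻ ω, ‖G ((⌊((n : ℝ) + 1) * t⌋ : ℝ) / (n + 1)) ω‖ₑ ∂P := by
          refine lintegral_congr_ae ?_
          filter_upwards [hAe ((⌊((n : ℝ) + 1) * t⌋ : ℝ) / (n + 1))] with ω hω
          rw [hω, hD]
      _ ≤ ENNReal.ofReal (2 * C * (1 + |t|)) := lintegral_enorm_floor_div_le hGi hC0 hC n t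
      _ = ENNReal.ofReal (2 * C) * ‖1 + |t|‖ₑ := by
          rw [ENNReal.ofReal_mul (by positivity), Real.enorm_of_nonneg (by positivity)]
  have hfin : ∫⁻ ω, liminf (fun n => J n ω) atTop ∂P ≤ K :=
    (lintegral_liminf_le hJm).trans (liminf_le_of_frequently_le'
      (Frequently.of_forall hJK))
  have hlt : ∀ᵐ ω ∂P, liminf (fun n => J n ω) atTop < ∞ :=
    ae_lt_top (.liminf hJm) (hfin.trans_lt hKtop).ne
  have hAG : ∀ᵐ ω ∂P, ∀ (n : ℕ) (k : ℤ), G ((k : ℝ) / (n + 1)) ω = A ((k : ℝ) / (n + 1)) ω :=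
    ae_all_iff.2 fun n => ae_all_iff.2 fun k => hAe _
  filter_upwards [hcont, hlt, hAG] with ω h1 h2 h3
  refine ⟨h1.aestronglyMeasurable.mul hψ.1, lt_of_le_of_lt ?_ h2⟩
  calc ∫⁻ t, ‖G t ω * ψ t‖ₑ = ∫⁻ t, liminf (fun n => ‖D n t ω * φ t‖ₑ) atTop := by
        refine lintegral_congr_ae ?_
        filter_upwards [hφψ] with t ht
        refine (Tendsto.liminf_eq ?_).symm
        rw [← ht]
        simp only [hD, ← h3]
        exact (continuous_enorm.tendsto _).comp
          (((h1.tendsto t).comp (tendsto_floor_div t)).mul_const _)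
    _ ≤ liminf (fun n => J n ω) atTop := by
        simp only [hJ]
        exact lintegral_liminf_le fun n => (hDφ n).comp measurable_prodMk_left

end GaussianIntegral

/-! ### Scaling of the wavelet coefficients -/

lemma rpow_two_mul_le_sq {H : ℝ} (hH0 : 0 < H) (hH1 : H < 1) (t : ℝ) :
    |t| ^ (2 * H) ≤ (1 + |t|) ^ 2 := by
  calc |t| ^ (2 * H) ≤ (1 + |t|) ^ (2 * H) :=
        Real.rpow_le_rpow (abs_nonneg t) (by linarith) (by linarith)
    _ ≤ (1 + |t|) ^ (2 : ℝ) :=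
        Real.rpow_le_rpow_of_exponent_le (by linarith [abs_nonneg t]) (by linarith)
    _ = _ := by norm_cast

lemma TrimeanHurst.IsWavelet.integrable {ψ : ℝ → ℝ} (hψ : IsWavelet ψ) : Integrable ψ := by
  have hpos : ∀ t : ℝ, 0 < 1 + |t| := fun t => by positivity
  have hm : AEStronglyMeasurable ψ volume := by
    have h1 : Continuous fun t : ℝ => (1 + |t|)⁻¹ :=
      Continuous.inv₀ (by fun_prop) fun t => (hpos t).ne'
    refine (h1.aestronglyMeasurable.mul hψ.integrable_weighted.1).congr (ae_of_all _ fun t => ?_)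
    simp only [Pi.mul_apply]
    rw [inv_mul_cancel_left₀ (hpos t).ne']
  refine hψ.integrable_weighted.mono hm (ae_of_all _ fun t => ?_)
  rw [norm_mul, Real.norm_of_nonneg (hpos t).le]
  nlinarith [norm_nonneg (ψ t), abs_nonneg t]

lemma gridVariance_const_mul (c : ℝ) (K : ℝ → ℝ → ℝ) (ψ : ℝ → ℝ) (R n : ℕ) :
    gridVariance (fun s t => c * K s t) ψ R n = c * gridVariance K ψ R n := by
  simp only [gridVariance, Finset.mul_sum]
  exact Finset.sum_congr rfl fun k _ => Finset.sum_congr rfl fun l _ => by ring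

/-- Substitute `u = 2^j (t - k)`; subtracting the constant `B k ω` is free because `ψ` has mean
zero. -/
lemma coeff_eq_integral_increment {Ω : Type*} {B : ℝ → Ω → ℝ} {ψ : ℝ → ℝ} (hψ : IsWavelet ψ) (j k : ℕ) {ω : Ω}
    (hint : Integrable fun u =>
      (B (k + ((2 : ℝ) ^ j)⁻¹ * u) ω - B k ω) * ψ u) :
    coeff ψ B j k ω = (2 : ℝ) ^ ((j : ℝ) / 2) * ((2 : ℝ) ^ j)⁻¹ *
      ∫ u, (B (k + ((2 : ℝ) ^ j)⁻¹ * u) ω - B k ω) * ψ u := by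
  set a : ℝ := (2 : ℝ) ^ j with ha
  have ha0 : 0 < a := by positivity
  have h1 : ∫ u, B (k + a⁻¹ * u) ω * ψ u = ∫ u, (B (k + a⁻¹ * u) ω - B k ω) * ψ u := by
    have h2 : ∀ u, B (k + a⁻¹ * u) ω * ψ u =
        (B (k + a⁻¹ * u) ω - B k ω) * ψ u + B k ω * ψ u := fun u => by ring
    simp_rw [h2]
    rw [integral_add hint (hψ.integrable.const_mul _), integral_const_mul, hψ.integral_eq_zero,
      mul_zero, add_zero]
  have h3 : ∫ t, B t ω * ψ (a * (t - k)) = a⁻¹ * ∫ u, B (k + a⁻¹ * u) ω * ψ u := by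
    have h4 := Measure.integral_comp_mul_left (fun u => B (k + a⁻¹ * u) ω * ψ u) a
    rw [abs_of_pos (inv_pos.2 ha0), smul_eq_mul] at h4
    rw [← h4, ← integral_sub_right_eq_self
      (fun t => B (k + a⁻¹ * (a * t)) ω * ψ (a * t)) (k : ℝ)]
    congr with t
    rw [inv_mul_cancel_left₀ ha0.ne']
    congr 2
    ring
  rw [← h1, mul_assoc, ← h3, ← integral_const_mul]
  simp only [coeff, atom]
  congr with t
  ring

section FractionalCovariance

variable {Ω : Type*} [MeasurableSpace Ω] {P : Measure Ω} [IsProbabilityMeasure P] {H : ℝ}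

lemma ae_integrable_path_of_fractional_covariance (hH0 : 0 < H) (hH1 : H < 1) {G : ℝ → Ω → ℝ}
    (hG : IsGaussianProcess G P) (h0 : ∀ t, ∫ ω, G t ω ∂P = 0)
    (hc : ∀ᵐ ω ∂P, Continuous fun t => G t ω) {c : ℝ} (hc0 : 0 ≤ c)
    (hcov : ∀ s t, covariance (G s) (G t) P =
      c * ((|s| ^ (2 * H) + |t| ^ (2 * H) - |s - t| ^ (2 * H)) / 2))
    {ψ : ℝ → ℝ} (hψ : IsWavelet ψ) : ∀ᵐ ω ∂P, Integrable fun t => G t ω * ψ t := by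
  have hL : ∀ t, MemLp (G t) 2 P := fun t => (hG.hasGaussianLaw_eval t).memLp_two
  have hi : ∀ t, Integrable (G t) P := fun t => (hL t).integrable (by norm_num)
  refine ae_integrable_path hc hi (C := (1 + c) / 2) (fun t => ?_) hψ.integrable
    hψ.integrable_weighted
  have ha : 0 < 1 + |t| := by positivity
  have hsq : ∫ ω, G t ω ^ 2 ∂P = c * |t| ^ (2 * H) := by
    have := variance_of_integral_eq_zero (hi t).aemeasurable (h0 t)
    rw [← this, ← covariance_self (hi t).aemeasurable, hcov, sub_self, abs_zero,
      Real.zero_rpow (by positivity)]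
    ring
  calc ∫ ω, |G t ω| ∂P ≤ ∫ ω, ((1 + |t|) / 2 + (2 * (1 + |t|))⁻¹ * G t ω ^ 2) ∂P := by
        refine integral_mono (hi t).abs ((integrable_const _).add
          ((hL t).integrable_sq.const_mul _)) fun ω => ?_
        -- The square yields `|x| ≤ a / 2 + x² / (2a)`. Taking `a = 1 + |t|` matches the
        -- second-moment bound `c a²`, so the mean grows linearly.
        have h2 : 0 ≤ (2 * (1 + |t|))⁻¹ * (|G t ω| - (1 + |t|)) ^ 2 := by positivity
        have h3 : (2 * (1 + |t|))⁻¹ * (|G t ω| - (1 + |t|)) ^ 2 =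
            (1 + |t|) / 2 + (2 * (1 + |t|))⁻¹ * G t ω ^ 2 - |G t ω| := by
          rw [sub_sq, sq_abs]
          field_simp
          ring
        linarith
    _ = (1 + |t|) / 2 + (2 * (1 + |t|))⁻¹ * (c * |t| ^ (2 * H)) := by
        rw [integral_add (integrable_const _) ((hL t).integrable_sq.const_mul _),
          integral_const_mul, hsq]
        simp
    _ ≤ (1 + |t|) / 2 + (2 * (1 + |t|))⁻¹ * (c * (1 + |t|) ^ 2) := by
        gcongr
        exact rpow_two_mul_le_sq hH0 hH1 t
    _ = (1 + c) / 2 * (1 + |t|) := by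
        field_simp

/-- The integral of a wavelet against a continuous centred Gaussian process whose covariance is
`c` times that of fractional Brownian motion is centred Gaussian, with variance proportional to
`c`. -/
lemma exists_law_integral_of_fractional_covariance (hH0 : 0 < H) (hH1 : H < 1) {B : ℝ → Ω → ℝ}
    (hB : IsFBM B H P) {ψ : ℝ → ℝ} (hψ : IsWavelet ψ) :
    ∃ v : ℝ≥0, ∀ (c : ℝ≥0) (G : ℝ → Ω → ℝ), IsGaussianProcess G P →
      (∀ t, ∫ ω, G t ω ∂P = 0) → (∀ᵐ ω ∂P, Continuous fun t => G t ω) →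
      (∀ s t, covariance (G s) (G t) P =
        c * ((|s| ^ (2 * H) + |t| ^ (2 * H) - |s - t| ^ (2 * H)) / 2)) →
      AEMeasurable (fun ω => ∫ t, G t ω * ψ t) P ∧
        P.map (fun ω => ∫ t, G t ω * ψ t) = gaussianReal 0 (c * v) := by
  obtain ⟨w, v, hw, hv, -, -⟩ := exists_law_integral hB.gaussian hB.centred hB.continuous_paths
    hψ.integrable (ae_integrable_path_of_fractional_covariance hH0 hH1 hB.gaussian hB.centred
      hB.continuous_paths zero_le_one (by simpa using hB.covariance_eq) hψ)
  refine ⟨v, fun c G hG h0 hc hcov => ?_⟩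
  obtain ⟨w', v', hw', hv', hm, hlaw⟩ := exists_law_integral hG h0 hc
    hψ.integrable (ae_integrable_path_of_fractional_covariance hH0 hH1 hG h0 hc c.coe_nonneg hcov hψ)
  -- Uniqueness of limits carries the factor `c` through the mesh limit, and next through the limit
  -- in `R`.
  have hww : ∀ R, w' R = c * w R := by
    intro R
    refine tendsto_nhds_unique (hw' R) (((hw R).const_mul c).congr fun n => ?_)
    simp only [hcov, hB.covariance_eq, gridVariance_const_mul]
    rw [Real.toNNReal_mul c.coe_nonneg, Real.toNNReal_coe]
  have hvv : v' = c * v :=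
    tendsto_nhds_unique hv' ((hv.const_mul c).congr fun R => (hww R).symm)
  exact ⟨hm, hvv ▸ hlaw⟩

/-- Stationary increments and self-similarity: the powers of `|k|`, `|k + a s|` and `|k + a t|`
cancel, and each surviving term carries `a^(2H)`. -/
lemma covariance_fbm_increment (hH0 : 0 < H) {B : ℝ → Ω → ℝ} (hB : IsFBM B H P) (k : ℝ) {a : ℝ}
    (ha : 0 < a) (s t : ℝ) :
    covariance (fun ω => B (k + a * s) ω - B k ω) (fun ω => B (k + a * t) ω - B k ω) P =
      a ^ (2 * H) * ((|s| ^ (2 * H) + |t| ^ (2 * H) - |s - t| ^ (2 * H)) / 2) := by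
  have hL : ∀ t, MemLp (B t) 2 P := fun t => (hB.gaussian.hasGaussianLaw_eval t).memLp_two
  have habs : ∀ x, |a * x| ^ (2 * H) = a ^ (2 * H) * |x| ^ (2 * H) := fun x => by
    rw [abs_mul, abs_of_pos ha, Real.mul_rpow ha.le (abs_nonneg x)]
  have hs : MemLp (fun ω => B (k + a * t) ω - B k ω) 2 P := (hL _).sub (hL _)
  rw [covariance_fun_sub_left (hL _) (hL _) hs,
    covariance_fun_sub_right (hL _) (hL _) (hL _), covariance_fun_sub_right (hL _) (hL _) (hL _)]
  simp only [hB.covariance_eq]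
  rw [show k + a * s - (k + a * t) = a * (s - t) by ring, show k + a * s - k = a * s by ring,
    show k - (k + a * t) = -(a * t) by ring, abs_neg, habs, habs, habs, sub_self, abs_zero,
    Real.zero_rpow (by positivity)]
  ring

/-- The non-decimated wavelet coefficients of fractional Brownian motion are centred Gaussian, and
their variance decays geometrically in the level. -/
lemma exists_map_coeff (hH0 : 0 < H) (hH1 : H < 1) {B : ℝ → Ω → ℝ}
    (hB : IsFBM B H P) {ψ : ℝ → ℝ} (hψ : IsWavelet ψ) :
    ∃ v : ℝ≥0, ∀ j k : ℕ, AEMeasurable (coeff ψ B j k) P ∧ P.map (coeff ψ B j k) =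
      gaussianReal 0 ((2 : ℝ≥0) ^ (-((2 * H + 1) * j)) * v) := by
  obtain ⟨v, hv⟩ := exists_law_integral_of_fractional_covariance hH0 hH1 hB hψ
  refine ⟨v, fun j k => ?_⟩
  set a : ℝ := (2 : ℝ) ^ j with ha
  have ha0 : 0 < a := by positivity
  have haj : a⁻¹ = (2 : ℝ) ^ (-(j : ℝ)) := by
    rw [ha, ← Real.rpow_natCast, Real.rpow_neg zero_le_two]
  set c : ℝ≥0 := (2 : ℝ≥0) ^ (-(j : ℝ) * (2 * H)) with hc
  have hca : (c : ℝ) = a⁻¹ ^ (2 * H) := by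
    rw [hc, NNReal.coe_rpow, haj, ← Real.rpow_mul zero_le_two, NNReal.coe_ofNat]
  set G : ℝ → Ω → ℝ := fun u ω => B (k + a⁻¹ * u) ω - B k ω with hG
  have hGg : IsGaussianProcess G P := (hB.gaussian.shift (k : ℝ)).comp_right fun u => a⁻¹ * u
  have hi : ∀ t, Integrable (B t) P := fun t => (hB.gaussian.hasGaussianLaw_eval t).integrable
  have hG0 : ∀ t, ∫ ω, G t ω ∂P = 0 := fun t => by
    rw [hG, integral_sub (hi _) (hi _), hB.centred, hB.centred, sub_zero]
  have hGc : ∀ᵐ ω ∂P, Continuous fun t => G t ω := by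
    filter_upwards [hB.continuous_paths] with ω hω
    exact (hω.comp (by fun_prop : Continuous fun u : ℝ => (k : ℝ) + a⁻¹ * u)).sub
      continuous_const
  have hGcov : ∀ s t, covariance (G s) (G t) P =
      c * ((|s| ^ (2 * H) + |t| ^ (2 * H) - |s - t| ^ (2 * H)) / 2) := by
    rw [hca]
    exact covariance_fbm_increment hH0 hB k (inv_pos.2 ha0)
  obtain ⟨hm, hlaw⟩ := hv c G hGg hG0 hGc hGcov
  have hae : (fun ω => (2 : ℝ) ^ ((j : ℝ) / 2) * a⁻¹ * ∫ t, G t ω * ψ t) =ᵐ[P]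
      coeff ψ B j k := by
    filter_upwards [ae_integrable_path_of_fractional_covariance hH0 hH1 hGg hG0 hGc c.coe_nonneg hGcov hψ]
      with ω hω using (coeff_eq_integral_increment hψ j k hω).symm
  refine ⟨(hm.const_mul _).congr hae, ?_⟩
  rw [← Measure.map_congr hae, ← Function.comp_def (fun x => (2 : ℝ) ^ ((j : ℝ) / 2) * a⁻¹ * x),
    ← AEMeasurable.map_map_of_aemeasurable (by fun_prop) hm, hlaw, gaussianReal_map_const_mul]
  congr 1
  · simp
  · ext
    rw [← mul_assoc, NNReal.coe_mul, NNReal.coe_mul, NNReal.coe_mul]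
    congr 1
    -- The exponents add up to `j - 2j - 2Hj`: normalisation, change of variables, self-similarity.
    change ((2 : ℝ) ^ ((j : ℝ) / 2) * a⁻¹) ^ 2 * (c : ℝ) = _
    rw [hca, haj, ← Real.rpow_mul zero_le_two, ← Real.rpow_add zero_lt_two, ← Real.rpow_natCast,
      ← Real.rpow_mul zero_le_two, ← Real.rpow_add zero_lt_two, NNReal.coe_rpow, NNReal.coe_ofNat]
    congr 1
    push_cast
    ring

end FractionalCovariance

/-! ### Consistency and least squares -/

/-- Convergence in distribution to zero implies convergence in measure. -/
lemma tendstoInMeasure_zero_of_tendstoInDistribution {Ω Ω' : Type*} [MeasurableSpace Ω]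
    [MeasurableSpace Ω'] {P : Measure Ω} [IsProbabilityMeasure P] {Q : Measure Ω'}
    [IsProbabilityMeasure Q] {X : ℕ → Ω → ℝ}
    (h : TendstoInDistribution X atTop (fun _ : Ω' => (0 : ℝ)) (fun _ => P) Q) :
    TendstoInMeasure P X atTop fun _ => 0 := by
  rw [tendstoInMeasure_iff_norm]
  intro ε hε
  have hclosed : IsClosed {x : ℝ | ε ≤ ‖x‖} := isClosed_le continuous_const continuous_norm
  have hdirac : Q.map (fun _ => (0 : ℝ)) = Measure.dirac 0 := by
    rw [Measure.map_const, measure_univ, one_smul]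
  have hzero : Measure.dirac (0 : ℝ) {x : ℝ | ε ≤ ‖x‖} = 0 := by
    rw [Measure.dirac_apply' _ hclosed.measurableSet]
    simp [hε]
  have hfr : Q.map (fun _ => (0 : ℝ)) (frontier {x : ℝ | ε ≤ ‖x‖}) = 0 := by
    rw [hdirac]
    exact measure_mono_null hclosed.frontier_subset hzero
  have := ProbabilityMeasure.tendsto_measure_of_null_frontier_of_tendsto' h.tendsto hfr
  simp only [ProbabilityMeasure.coe_mk, hdirac, hzero] at this
  refine this.congr fun n => ?_
  rw [Measure.map_apply_of_aemeasurable (h.forall_aemeasurable n) hclosed.measurableSet]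
  simp

/-- A sequence that converges in distribution after centring and rescaling by a vanishing scale
converges in measure to its centre. -/
lemma tendstoInMeasure_of_tendstoInDistribution_div {Ω Ω' : Type*} [MeasurableSpace Ω]
    [MeasurableSpace Ω'] {P : Measure Ω} [IsProbabilityMeasure P] {Q : Measure Ω'}
    [IsProbabilityMeasure Q] {T : ℕ → Ω → ℝ} {m : ℝ} {s : ℕ → ℝ} {Z : Ω' → ℝ}
    (h : TendstoInDistribution (fun n ω => (T n ω - m) / s n) atTop Z (fun _ => P) Q)
    (hs : Tendsto s atTop (𝓝 0)) (hs0 : ∀ᶠ n in atTop, s n ≠ 0) :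
    TendstoInMeasure P T atTop fun _ => m := by
  have hsm : TendstoInMeasure P (fun n (_ : Ω) => s n) atTop fun _ => 0 :=
    tendstoInMeasure_of_tendsto_ae (fun _ => aestronglyMeasurable_const)
      (ae_of_all _ fun _ => hs)
  -- Slutsky again: multiplying back by the vanishing scale gives the limit `0`.
  have h1 := h.continuous_comp_prodMk_of_tendstoInMeasure_const (g := fun z : ℝ × ℝ => z.1 * z.2)
    (by fun_prop) hsm fun _ => aemeasurable_const
  simp only [mul_zero] at h1
  have h2 := tendstoInMeasure_zero_of_tendstoInDistribution h1
  rw [tendstoInMeasure_iff_norm] at h2 ⊢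
  intro ε hε
  refine (h2 ε hε).congr' ?_
  filter_upwards [hs0] with n hn
  simp [div_mul_cancel₀ _ hn]

lemma sum_sub_levelMean {J : ℕ} (hJ : 2 ≤ J) :
    ∑ j ∈ Finset.Icc 1 J, ((j : ℝ) - levelMean J) = 0 := by
  have : (J : ℝ) ≠ 0 := by positivity
  rw [Finset.sum_sub_distrib, Finset.sum_const, Nat.card_Icc, levelMean, nsmul_eq_mul,
    Nat.add_sub_cancel, mul_div_cancel₀ _ this, sub_self]

lemma sum_sub_levelMean_sq_pos {J : ℕ} (hJ : 2 ≤ J) :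
    0 < ∑ j ∈ Finset.Icc 1 J, ((j : ℝ) - levelMean J) ^ 2 := by
  refine Finset.sum_pos' (fun _ _ => sq_nonneg _) ?_
  -- The mean level cannot be both `1` and `2`, so one of these terms is positive.
  by_cases h : (1 : ℝ) - levelMean J = 0
  · refine ⟨2, Finset.mem_Icc.2 ⟨by norm_num, hJ⟩, ?_⟩
    rw [← sub_eq_zero.1 h]
    norm_num
  · refine ⟨1, Finset.mem_Icc.2 ⟨le_rfl, by omega⟩, ?_⟩
    push_cast
    positivity

/-- The least squares slope of an affine function is its slope. -/
lemma olsSlope_affine {J : ℕ} (hJ : 2 ≤ J) (a c : ℝ) :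
    olsSlope J (fun j => a * j + c) = a := by
  rw [olsSlope, div_eq_iff (sum_sub_levelMean_sq_pos hJ).ne', Finset.mul_sum, ← sub_eq_zero,
    ← Finset.sum_sub_distrib]
  calc _ = ∑ j ∈ Finset.Icc 1 J, (a * levelMean J + c) * ((j : ℝ) - levelMean J) :=
        Finset.sum_congr rfl fun j _ => by ring
    _ = 0 := by rw [← Finset.mul_sum, sum_sub_levelMean hJ, mul_zero]

lemma hurst_eq_olsSlope {J : ℕ} (hJ : 2 ≤ J) (H c : ℝ) :
    H = -(1 / (2 * Real.log 2)) *
      olsSlope J (fun j => -(2 * H + 1) * Real.log 2 * j + c) - 1 / 2 := by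
  have : 0 < Real.log 2 := Real.log_pos one_lt_two
  rw [olsSlope_affine hJ]
  field_simp
  ring

/-- Written as an affine function of finitely many statistics, the estimator falls under
`tendstoInMeasure_sum_mul`. -/
lemma hurstEst_eq_sum (J M : ℕ) (y : ℕ → ℕ → ℝ) :
    hurstEst J M y = ∑ z ∈ Finset.Icc 1 M ×ˢ Finset.Icc 1 J,
      (-(1 / (2 * Real.log 2)) * (1 / M) * (((z.2 : ℝ) - levelMean J) /
        ∑ j ∈ Finset.Icc 1 J, ((j : ℝ) - levelMean J) ^ 2)) * y z.2 z.1 - 1 / 2 := by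
  rw [hurstEst, Finset.sum_product, ← mul_assoc, Finset.mul_sum]
  congr 1
  refine Finset.sum_congr rfl fun i _ => ?_
  rw [olsSlope, Finset.sum_div, Finset.mul_sum]
  exact Finset.sum_congr rfl fun j _ => by ring

/-- Consistency of the estimator of the Hurst exponent. -/
lemma tendstoInMeasure_hurstEst {Ω : Type*} [MeasurableSpace Ω] {P : Measure Ω} {J M : ℕ}
    (hM : 0 < M) (hJ : 2 ≤ J) {H c : ℝ} {y : ℕ → Ω → ℕ → ℕ → ℝ}
    (h : ∀ j ∈ Finset.Icc 1 J, ∀ i ∈ Finset.Icc 1 M, TendstoInMeasure P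
      (fun n ω => y n ω j i) atTop fun _ => -(2 * H + 1) * Real.log 2 * j + c) :
    TendstoInMeasure P (fun n ω => hurstEst J M (y n ω)) atTop fun _ => H := by
  have hH : H = hurstEst J M fun j _ => -(2 * H + 1) * Real.log 2 * j + c := by
    have hM' : (M : ℝ) ≠ 0 := by positivity
    rw [hurstEst, Finset.sum_const, Nat.card_Icc, Nat.add_sub_cancel, nsmul_eq_mul,
      ← mul_assoc (1 / (M : ℝ)), one_div_mul_cancel hM', one_mul]
    exact hurst_eq_olsSlope hJ H c
  have hsum := tendstoInMeasure_sum_mul (P := P) (l := atTop) (Finset.Icc 1 M ×ˢ Finset.Icc 1 J)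
    (fun z => -(1 / (2 * Real.log 2)) * (1 / M) * (((z.2 : ℝ) - levelMean J) /
        ∑ j ∈ Finset.Icc 1 J, ((j : ℝ) - levelMean J) ^ 2))
    (R := fun z n ω => y n ω z.2 z.1) fun z hz =>
      h z.2 (Finset.mem_product.1 hz).2 z.1 (Finset.mem_product.1 hz).1
  rw [hurstEst_eq_sum] at hH
  simp only [hurstEst_eq_sum J M (y _ _)]
  rw [tendstoInMeasure_iff_norm] at hsum ⊢
  intro ε hε
  refine (hsum ε hε).congr fun n => ?_
  congr 1
  ext ω
  simp only [Set.mem_ofPred_eq]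
  rw [← eq_sub_iff_add_eq.1 hH, sub_sub, add_comm]

/-! ### Asymptotics of the groups of logged mid-energies -/

/-- The variance of the wavelet coefficients at level `j`. -/
noncomputable def levelVariance (H σ : ℝ) (j : ℕ) : ℝ≥0 :=
  (2 : ℝ≥0) ^ (-((2 * H + 1) * j)) * (σ ^ 2).toNNReal

lemma levelVariance_ne_zero (H : ℝ) {σ : ℝ} (hσ : 0 < σ) (j : ℕ) : levelVariance H σ j ≠ 0 := by
  have h1 : 0 < (2 : ℝ≥0) ^ (-((2 * H + 1) * j)) := NNReal.rpow_pos two_pos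
  have h2 : 0 < (σ ^ 2).toNNReal := Real.toNNReal_pos.2 (by positivity)
  exact (mul_pos h1 h2).ne'

lemma log_levelVariance (H : ℝ) {σ : ℝ} (hσ : 0 < σ) (j : ℕ) :
    Real.log (levelVariance H σ j) = -(2 * H + 1) * Real.log 2 * j + Real.log (σ ^ 2) := by
  rw [levelVariance, NNReal.coe_mul, NNReal.coe_rpow, Real.coe_toNNReal _ (by positivity),
    NNReal.coe_ofNat, Real.log_mul (by positivity) (by positivity), Real.log_rpow two_pos]
  ring

lemma logEnergyQuantile_levelVariance (H : ℝ) {σ : ℝ} (hσ : 0 < σ) (j : ℕ) {p : ℝ} (hp0 : 0 < p)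
    (hp1 : p < 1) : logEnergyQuantile (levelVariance H σ j) p =
      -(2 * H + 1) * Real.log 2 * j + Real.log (σ ^ 2) + Real.log (-Real.log (1 - p)) := by
  have hl : 0 < -Real.log (1 - p) := neg_pos.2 (Real.log_neg (by linarith) (by linarith))
  rw [logEnergyQuantile, Real.log_mul (NNReal.coe_ne_zero.2 (levelVariance_ne_zero H hσ j)) hl.ne',
    log_levelVariance H hσ]

section Coefficients

variable {Ω : Type*} [MeasurableSpace Ω] {P : Measure Ω} [IsProbabilityMeasure P] {H : ℝ}
  {B : ℝ → Ω → ℝ} {ψ : ℝ → ℝ} {σ : ℝ}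

lemma map_coeff (hH0 : 0 < H) (hH1 : H < 1) (hB : IsFBM B H P) (hψ : IsWavelet ψ)
    (hvar : variance (coeff ψ B 0 1) P = σ ^ 2) (j k : ℕ) :
    AEMeasurable (coeff ψ B j k) P ∧
      P.map (coeff ψ B j k) = gaussianReal 0 (levelVariance H σ j) := by
  obtain ⟨v, hv⟩ := exists_map_coeff hH0 hH1 hB hψ
  -- The scaling factor is `1` at level `0`. The law does not depend on the shift, so the
  -- coefficient at `k = 1` determines `v`.
  have hvσ : v = (σ ^ 2).toNNReal := by
    obtain ⟨hm, hlaw⟩ := hv 0 1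
    rw [← hvar, ← variance_id_map hm, hlaw, variance_id_gaussianReal]
    simp
  rw [levelVariance, ← hvσ]
  exact hv j k

lemma aemeasurable_logGroup (hH0 : 0 < H) (hH1 : H < 1) (hB : IsFBM B H P) (hψ : IsWavelet ψ)
    (hvar : variance (coeff ψ B 0 1) P = σ ^ 2) (N M j i : ℕ) (m : Fin (N / 2 / M)) :
    AEMeasurable (fun ω => logGroup ψ B N M j i ω m) P := by
  have h := fun k => (map_coeff hH0 hH1 hB hψ hvar j k).1
  exact Real.measurable_log.comp_aemeasurable
    ((((h _).pow_const 2).add ((h _).pow_const 2)).div_const 2)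

lemma two_mul_mul_div_two_div {M : ℕ} (hM : 0 < M) (n : ℕ) : 2 * M * n / 2 / M = n := by
  rw [mul_assoc, Nat.mul_div_cancel_left _ two_pos, Nat.mul_div_cancel_left _ hM]

/-- Asymptotic normality of a general trimean of a group of logged mid-energies. -/
theorem tendstoInDistribution_generalTrimean_logGroup (hH0 : 0 < H) (hH1 : H < 1)
    (hB : IsFBM B H P) (hψ : IsWavelet ψ) (hσ : 0 < σ)
    (hvar : variance (coeff ψ B 0 1) P = σ ^ 2) {J M : ℕ} (hM : 0 < M)
    (hpair : ∀ᶠ n : ℕ in atTop, ∀ j ∈ Finset.Icc 1 J, ∀ k ∈ Finset.Icc 1 (2 * M * n / 2),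
      IndepFun (coeff ψ B j k) (coeff ψ B j (k + 2 * M * n / 2)) P)
    (hgroup : ∀ᶠ n : ℕ in atTop, ∀ j ∈ Finset.Icc 1 J, ∀ i ∈ Finset.Icc 1 M,
      iIndepFun (fun m ω => logGroup ψ B (2 * M * n) M j i ω m) P)
    {j i : ℕ} (hj : j ∈ Finset.Icc 1 J) (hi : i ∈ Finset.Icc 1 M)
    (α p : ℝ) (hp0 : 0 < p) (hp1 : p < 1) {m v : ℝ} {V : ℕ → ℝ} (hv : 0 < v)
    (hm : m = ∑ r, ![α / 2, 1 - α, α / 2] r *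
      logEnergyQuantile (levelVariance H σ j) (![p, 1 / 2, 1 - p] r))
    (hv' : v = ∑ r, ∑ r', ![α / 2, 1 - α, α / 2] r * ![α / 2, 1 - α, α / 2] r' *
      ((min (![p, 1 / 2, 1 - p] r) (![p, 1 / 2, 1 - p] r') -
        ![p, 1 / 2, 1 - p] r * ![p, 1 / 2, 1 - p] r') /
          (-((1 - ![p, 1 / 2, 1 - p] r) * Real.log (1 - ![p, 1 / 2, 1 - p] r)) *
            -((1 - ![p, 1 / 2, 1 - p] r') * Real.log (1 - ![p, 1 / 2, 1 - p] r')))))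
    (hV : ∀ n : ℕ, 0 < n → V n = v / n) :
    TendstoInDistribution
      (fun (n : ℕ) ω => (generalTrimean α p (logGroup ψ B (2 * M * n) M j i ω) - m) / √(V n))
      atTop (id : ℝ → ℝ) (fun _ => P) (gaussianReal 0 1) := by
  have hv0 := levelVariance_ne_zero H hσ j
  have hpr : ∀ r, 0 < ![p, 1 / 2, 1 - p] r ∧ ![p, 1 / 2, 1 - p] r < 1 := by
    intro r
    fin_cases r
    · exact ⟨hp0, hp1⟩
    · norm_num
    · exact ⟨sub_pos.2 hp1, sub_lt_self _ hp0⟩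
  refine tendstoInDistribution_generalTrimean (ν := logEnergyLaw (levelVariance H σ j))
    (k := fun n => 2 * M * n / 2 / M) (two_mul_mul_div_two_div hM)
    (x := fun n r ω => logGroup ψ B (2 * M * n) M j i ω r)
    (fun n r => aemeasurable_logGroup hH0 hH1 hB hψ hvar _ _ _ _ _) ?_ ?_ α p hp0 hp1
    (q := fun r => logEnergyQuantile (levelVariance H σ j) (![p, 1 / 2, 1 - p] r))
    (f := fun r => -((1 - ![p, 1 / 2, 1 - p] r) * Real.log (1 - ![p, 1 / 2, 1 - p] r)))
    (fun r => logEnergyLaw_real_Iic_quantile hv0 (hpr r).1 (hpr r).2) (fun r => ?_)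
    (fun r => hasDerivAt_logEnergyLaw_real_Iic hv0 (hpr r).1 (hpr r).2) hv hm hv' hV
  · filter_upwards [hgroup] with n hn using hn j hj i hi
  · filter_upwards [hpair] with n hn r
    -- The indices of a group stay below `M * n = N / 2`, the range in which pairs are independent.
    have hk : i + (r : ℕ) * M ∈ Finset.Icc 1 (2 * M * n / 2) := by
      have hr : (r : ℕ) < n := r.2.trans_eq (two_mul_mul_div_two_div hM n)
      obtain ⟨h1, h2⟩ := Finset.mem_Icc.1 hi
      refine Finset.mem_Icc.2 ⟨by omega, ?_⟩
      calc i + (r : ℕ) * M ≤ M + (r : ℕ) * M := by omega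
        _ = M * (r + 1) := by ring
        _ ≤ M * n := Nat.mul_le_mul_left _ hr
        _ = 2 * M * n / 2 := by rw [mul_assoc, Nat.mul_div_cancel_left _ two_pos]
    have h := fun k => map_coeff hH0 hH1 hB hψ hvar j k
    exact map_log_half_sq_add_sq (h _).1 (h _).1 (h _).2 (h _).2 (hn j hj _ hk)
  · have h1 := hpr r
    exact neg_pos.2 (mul_neg_of_pos_of_neg (by linarith) (Real.log_neg (by linarith) (by linarith)))

end Coefficients

/-! ### The explicit constants -/

/-- At the three levels `-log(1 - p)` is `log(4/3)`, `log 2` and `2 log 2`. The constant `c₃` uses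
larger logarithms, and its term `-log 2` offsets the extra factors of two. -/
lemma tukey_mean_eq (H : ℝ) {σ : ℝ} (hσ : 0 < σ) (j : ℕ) :
    -(2 * H + 1) * Real.log 2 * j + c₃ σ = ∑ r, ![(1 / 2 : ℝ) / 2, 1 - 1 / 2, 1 / 2 / 2] r *
      logEnergyQuantile (levelVariance H σ j) (![(1 / 4 : ℝ), 1 / 2, 1 - 1 / 4] r) := by
  simp only [Fin.sum_univ_three, Matrix.cons_val]
  rw [logEnergyQuantile_levelVariance H hσ j (by norm_num) (by norm_num),
    logEnergyQuantile_levelVariance H hσ j (by norm_num) (by norm_num),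
    logEnergyQuantile_levelVariance H hσ j (by norm_num) (by norm_num), c₃]
  have h2 : 0 < Real.log 2 := Real.log_pos one_lt_two
  have ha : 0 < Real.log (4 / 3) := Real.log_pos (by norm_num)
  have e1 : -Real.log (1 - 1 / 4) = Real.log (4 / 3) := by
    rw [← Real.log_inv]; norm_num
  have e2 : -Real.log (1 - 1 / 2) = Real.log 2 := by
    rw [← Real.log_inv]; norm_num
  have e3 : -Real.log (1 - (1 - 1 / 4)) = 2 * Real.log 2 := by
    rw [← Real.log_inv, ← Real.log_rpow two_pos]; norm_num
  have e4 : Real.log (16 / 9) = 2 * Real.log (4 / 3) := by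
    rw [← Real.log_rpow (by norm_num)]; norm_num
  have e5 : Real.log 16 = 4 * Real.log 2 := by
    rw [← Real.log_rpow two_pos]; norm_num
  have e6 : Real.log 4 = 2 * Real.log 2 := by
    rw [← Real.log_rpow two_pos]; norm_num
  rw [e1, e2, e3, e4, e5, e6, Real.log_mul (by positivity) (by positivity),
    Real.log_mul two_ne_zero ha.ne', Real.log_mul (by norm_num) h2.ne',
    Real.log_mul two_ne_zero h2.ne', e6]
  ring

lemma gastwirth_mean_eq (H : ℝ) {σ : ℝ} (hσ : 0 < σ) (j : ℕ) :
    -(2 * H + 1) * Real.log 2 * j + c₄ σ = ∑ r, ![(3 / 5 : ℝ) / 2, 1 - 3 / 5, 3 / 5 / 2] r *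
      logEnergyQuantile (levelVariance H σ j) (![(1 / 3 : ℝ), 1 / 2, 1 - 1 / 3] r) := by
  simp only [Fin.sum_univ_three, Matrix.cons_val]
  rw [logEnergyQuantile_levelVariance H hσ j (by norm_num) (by norm_num),
    logEnergyQuantile_levelVariance H hσ j (by norm_num) (by norm_num),
    logEnergyQuantile_levelVariance H hσ j (by norm_num) (by norm_num), c₄]
  have h2 : 0 < Real.log 2 := Real.log_pos one_lt_two
  have h3 : 0 < Real.log 3 := Real.log_pos (by norm_num)
  have ha : 0 < Real.log (3 / 2) := Real.log_pos (by norm_num)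
  have e1 : -Real.log (1 - 1 / 3) = Real.log (3 / 2) := by
    rw [← Real.log_inv]; norm_num
  have e2 : -Real.log (1 - 1 / 2) = Real.log 2 := by
    rw [← Real.log_inv]; norm_num
  have e3 : -Real.log (1 - (1 - 1 / 3)) = Real.log 3 := by
    rw [← Real.log_inv]; norm_num
  have e4 : Real.log (9 / 4) = 2 * Real.log (3 / 2) := by
    rw [← Real.log_rpow (by norm_num)]; norm_num
  have e5 : Real.log 9 = 2 * Real.log 3 := by
    rw [← Real.log_rpow (by norm_num)]; norm_num
  have e6 : Real.log 4 = 2 * Real.log 2 := by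
    rw [← Real.log_rpow two_pos]; norm_num
  rw [e1, e2, e3, e4, e5, e6, Real.log_mul two_ne_zero ha.ne', Real.log_mul two_ne_zero h3.ne',
    Real.log_mul two_ne_zero h2.ne']
  ring

/-- The constant `n V₁` for samples of size `n`. -/
noncomputable def tukeyVariance : ℝ :=
  1 / 4 * (1 / (12 * Real.log (3 / 4) ^ 2) + 1 / (3 * Real.log (3 / 4) * Real.log (1 / 2)) +
      1 / (6 * Real.log (3 / 4) * Real.log (1 / 4)) + 1 / Real.log (1 / 2) ^ 2 +
      1 / (Real.log (1 / 2) * Real.log (1 / 4)) + 3 / (4 * Real.log (1 / 4) ^ 2))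

/-- The constant `n V₂` for samples of size `n`. -/
noncomputable def gastwirthVariance : ℝ :=
  0.09 / (2 * Real.log (2 / 3) ^ 2) + 0.12 / (Real.log (2 / 3) * Real.log (1 / 2)) +
      0.09 / (Real.log (1 / 3) * Real.log (2 / 3)) + 0.16 / Real.log (1 / 2) ^ 2 +
      0.24 / (Real.log (1 / 2) * Real.log (1 / 3)) + 0.18 / Real.log (1 / 3) ^ 2

lemma log_neg_of_lt_one {x : ℝ} (h0 : 0 < x) (h1 : x < 1) : ∃ a, 0 < a ∧ Real.log x = -a :=
  ⟨-Real.log x, neg_pos.2 (Real.log_neg h0 h1), (neg_neg _).symm⟩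

/-- The logarithms are negative but occur in pairs, so every term is positive. -/
lemma tukeyVariance_pos : 0 < tukeyVariance := by
  obtain ⟨a, ha, ha'⟩ := log_neg_of_lt_one (x := 3 / 4) (by norm_num) (by norm_num)
  obtain ⟨b, hb, hb'⟩ := log_neg_of_lt_one (x := 1 / 2) (by norm_num) (by norm_num)
  obtain ⟨c, hc, hc'⟩ := log_neg_of_lt_one (x := 1 / 4) (by norm_num) (by norm_num)
  rw [tukeyVariance, ha', hb', hc']
  simp only [mul_neg, neg_mul, neg_neg, neg_sq]
  positivity

lemma gastwirthVariance_pos : 0 < gastwirthVariance := by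
  obtain ⟨a, ha, ha'⟩ := log_neg_of_lt_one (x := 2 / 3) (by norm_num) (by norm_num)
  obtain ⟨b, hb, hb'⟩ := log_neg_of_lt_one (x := 1 / 2) (by norm_num) (by norm_num)
  obtain ⟨c, hc, hc'⟩ := log_neg_of_lt_one (x := 1 / 3) (by norm_num) (by norm_num)
  rw [gastwirthVariance, ha', hb', hc']
  simp only [mul_neg, neg_mul, neg_neg, neg_sq]
  positivity

/-- With `N = 2 * M * n`, the factor `M / (2 * N)` is `1 / (4 * n)`; at `n = 0` both sides are `0`
by the convention for division. -/
lemma V₁_eq {M : ℕ} (hM : 0 < M) (n : ℕ) : V₁ M (2 * M * n) = tukeyVariance / n := by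
  have hM' : (M : ℝ) ≠ 0 := by positivity
  rw [V₁, tukeyVariance, mul_comm (1 / 4 : ℝ), mul_div_assoc, mul_comm]
  congr 1
  push_cast
  rcases Nat.eq_zero_or_pos n with rfl | hn
  · simp
  · field_simp
    norm_num

lemma V₂_eq {M : ℕ} (hM : 0 < M) (n : ℕ) : V₂ M (2 * M * n) = gastwirthVariance / n := by
  have hM' : (M : ℝ) ≠ 0 := by positivity
  rw [V₂, gastwirthVariance, div_eq_mul_one_div, mul_comm]
  rw [div_eq_mul_one_div _ (n : ℝ)]
  congr 1
  push_cast
  rcases Nat.eq_zero_or_pos n with rfl | hn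
  · simp
  · field_simp

lemma tukeyVariance_eq : tukeyVariance =
    ∑ r, ∑ r', ![(1 / 2 : ℝ) / 2, 1 - 1 / 2, 1 / 2 / 2] r *
      ![(1 / 2 : ℝ) / 2, 1 - 1 / 2, 1 / 2 / 2] r' *
      ((min (![(1 / 4 : ℝ), 1 / 2, 1 - 1 / 4] r) (![(1 / 4 : ℝ), 1 / 2, 1 - 1 / 4] r') -
        ![(1 / 4 : ℝ), 1 / 2, 1 - 1 / 4] r * ![(1 / 4 : ℝ), 1 / 2, 1 - 1 / 4] r') /
          (-((1 - ![(1 / 4 : ℝ), 1 / 2, 1 - 1 / 4] r) *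
            Real.log (1 - ![(1 / 4 : ℝ), 1 / 2, 1 - 1 / 4] r)) *
            -((1 - ![(1 / 4 : ℝ), 1 / 2, 1 - 1 / 4] r') *
              Real.log (1 - ![(1 / 4 : ℝ), 1 / 2, 1 - 1 / 4] r')))) := by
  obtain ⟨a, ha, ha'⟩ := log_neg_of_lt_one (x := 3 / 4) (by norm_num) (by norm_num)
  obtain ⟨b, hb, hb'⟩ := log_neg_of_lt_one (x := 1 / 2) (by norm_num) (by norm_num)
  obtain ⟨c, hc, hc'⟩ := log_neg_of_lt_one (x := 1 / 4) (by norm_num) (by norm_num)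
  simp only [Fin.sum_univ_three, Matrix.cons_val]
  rw [show (1 - 1 / 4 : ℝ) = 3 / 4 by norm_num, show (1 - 1 / 2 : ℝ) = 1 / 2 by norm_num,
    show (1 - 3 / 4 : ℝ) = 1 / 4 by norm_num, tukeyVariance, ha', hb', hc',
    min_self, min_self, min_self, min_eq_left (show (1 / 4 : ℝ) ≤ 1 / 2 by norm_num),
    min_eq_left (show (1 / 4 : ℝ) ≤ 3 / 4 by norm_num),
    min_eq_left (show (1 / 2 : ℝ) ≤ 3 / 4 by norm_num),
    min_eq_right (show (1 / 4 : ℝ) ≤ 1 / 2 by norm_num),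
    min_eq_right (show (1 / 4 : ℝ) ≤ 3 / 4 by norm_num),
    min_eq_right (show (1 / 2 : ℝ) ≤ 3 / 4 by norm_num)]
  field_simp
  ring

lemma gastwirthVariance_eq : gastwirthVariance =
    ∑ r, ∑ r', ![(3 / 5 : ℝ) / 2, 1 - 3 / 5, 3 / 5 / 2] r *
      ![(3 / 5 : ℝ) / 2, 1 - 3 / 5, 3 / 5 / 2] r' *
      ((min (![(1 / 3 : ℝ), 1 / 2, 1 - 1 / 3] r) (![(1 / 3 : ℝ), 1 / 2, 1 - 1 / 3] r') -
        ![(1 / 3 : ℝ), 1 / 2, 1 - 1 / 3] r * ![(1 / 3 : ℝ), 1 / 2, 1 - 1 / 3] r') /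
          (-((1 - ![(1 / 3 : ℝ), 1 / 2, 1 - 1 / 3] r) *
            Real.log (1 - ![(1 / 3 : ℝ), 1 / 2, 1 - 1 / 3] r)) *
            -((1 - ![(1 / 3 : ℝ), 1 / 2, 1 - 1 / 3] r') *
              Real.log (1 - ![(1 / 3 : ℝ), 1 / 2, 1 - 1 / 3] r')))) := by
  obtain ⟨a, ha, ha'⟩ := log_neg_of_lt_one (x := 2 / 3) (by norm_num) (by norm_num)
  obtain ⟨b, hb, hb'⟩ := log_neg_of_lt_one (x := 1 / 2) (by norm_num) (by norm_num)
  obtain ⟨c, hc, hc'⟩ := log_neg_of_lt_one (x := 1 / 3) (by norm_num) (by norm_num)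
  simp only [Fin.sum_univ_three, Matrix.cons_val]
  rw [show (1 - 1 / 3 : ℝ) = 2 / 3 by norm_num, show (1 - 1 / 2 : ℝ) = 1 / 2 by norm_num,
    show (1 - 2 / 3 : ℝ) = 1 / 3 by norm_num, gastwirthVariance, ha', hb', hc',
    min_self, min_self, min_self, min_eq_left (show (1 / 3 : ℝ) ≤ 1 / 2 by norm_num),
    min_eq_left (show (1 / 3 : ℝ) ≤ 2 / 3 by norm_num),
    min_eq_left (show (1 / 2 : ℝ) ≤ 2 / 3 by norm_num),
    min_eq_right (show (1 / 3 : ℝ) ≤ 1 / 2 by norm_num),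
    min_eq_right (show (1 / 3 : ℝ) ≤ 2 / 3 by norm_num),
    min_eq_right (show (1 / 2 : ℝ) ≤ 2 / 3 by norm_num)]
  field_simp
  ring

lemma tendsto_sqrt_div_nat {V : ℕ → ℝ} {v : ℝ} (hv : 0 < v) (hV : ∀ n : ℕ, V n = v / n) :
    Tendsto (fun n => √(V n)) atTop (𝓝 0) ∧ ∀ᶠ n in atTop, √(V n) ≠ 0 := by
  simp only [hV]
  constructor
  · rw [← Real.sqrt_zero]
    exact (Real.continuous_sqrt.tendsto 0).comp (tendsto_const_div_atTop_nhds_zero_nat v)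
  · filter_upwards [eventually_gt_atTop 0] with n hn
    have : (0 : ℝ) < n := by exact_mod_cast hn
    exact (Real.sqrt_pos.2 (by positivity)).ne'

/-! ### The main theorem -/

theorem lemma3 {Ω : Type*} [MeasurableSpace Ω] (P : Measure Ω) [IsProbabilityMeasure P]
    (H : ℝ) (hH0 : 0 < H) (hH1 : H < 1) (B : ℝ → Ω → ℝ) (hB : IsFBM B H P)
    (ψ : ℝ → ℝ) (hψ : IsWavelet ψ)
    (σ : ℝ) (hσ : 0 < σ) (hvar : variance (coeff ψ B 0 1) P = σ ^ 2)
    (J M : ℕ) (hM : 0 < M)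
    -- the sample size is `N = 2 * M * n` with `n → ∞`
    (hpair : ∀ᶠ n : ℕ in atTop, ∀ j ∈ Finset.Icc 1 J, ∀ k ∈ Finset.Icc 1 (2 * M * n / 2),
      IndepFun (coeff ψ B j k) (coeff ψ B j (k + 2 * M * n / 2)) P)
    (hgroup : ∀ᶠ n : ℕ in atTop, ∀ j ∈ Finset.Icc 1 J, ∀ i ∈ Finset.Icc 1 M,
      iIndepFun (fun m ω => logGroup ψ B (2 * M * n) M j i ω m) P) :
    (∀ j ∈ Finset.Icc 1 J, ∀ i ∈ Finset.Icc 1 M,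
      TendstoInDistribution
        (fun (n : ℕ) ω => (tukey (logGroup ψ B (2 * M * n) M j i ω) -
          (-(2 * H + 1) * Real.log 2 * j + c₃ σ)) / √(V₁ M (2 * M * n)))
        atTop (id : ℝ → ℝ) (fun _ => P) (gaussianReal 0 1) ∧
      TendstoInDistribution
        (fun (n : ℕ) ω => (gastwirth (logGroup ψ B (2 * M * n) M j i ω) -
          (-(2 * H + 1) * Real.log 2 * j + c₄ σ)) / √(V₂ M (2 * M * n)))
        atTop (id : ℝ → ℝ) (fun _ => P) (gaussianReal 0 1)) ∧
    (2 ≤ J →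
      H = -(1 / (2 * Real.log 2)) *
        olsSlope J (fun j => -(2 * H + 1) * Real.log 2 * j + c₃ σ) - 1 / 2 ∧
      H = -(1 / (2 * Real.log 2)) *
        olsSlope J (fun j => -(2 * H + 1) * Real.log 2 * j + c₄ σ) - 1 / 2 ∧
      TendstoInMeasure P
        (fun (n : ℕ) ω => hurstEst J M fun j i => tukey (logGroup ψ B (2 * M * n) M j i ω))
        atTop (fun _ => H) ∧
      TendstoInMeasure P
        (fun (n : ℕ) ω => hurstEst J M fun j i => gastwirth (logGroup ψ B (2 * M * n) M j i ω))
        atTop (fun _ => H)) := by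

  have hT : ∀ j ∈ Finset.Icc 1 J, ∀ i ∈ Finset.Icc 1 M, TendstoInDistribution
      (fun (n : ℕ) ω => (tukey (logGroup ψ B (2 * M * n) M j i ω) -
        (-(2 * H + 1) * Real.log 2 * j + c₃ σ)) / √(V₁ M (2 * M * n)))
      atTop (id : ℝ → ℝ) (fun _ => P) (gaussianReal 0 1) := fun j hj i hi =>
    tendstoInDistribution_generalTrimean_logGroup hH0 hH1 hB hψ hσ hvar hM hpair hgroup hj hi
      (1 / 2) (1 / 4) (by norm_num) (by norm_num) tukeyVariance_pos (tukey_mean_eq H hσ j)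
      tukeyVariance_eq fun n _ => V₁_eq hM n
  have hG : ∀ j ∈ Finset.Icc 1 J, ∀ i ∈ Finset.Icc 1 M, TendstoInDistribution
      (fun (n : ℕ) ω => (gastwirth (logGroup ψ B (2 * M * n) M j i ω) -
        (-(2 * H + 1) * Real.log 2 * j + c₄ σ)) / √(V₂ M (2 * M * n)))
      atTop (id : ℝ → ℝ) (fun _ => P) (gaussianReal 0 1) := fun j hj i hi =>
    tendstoInDistribution_generalTrimean_logGroup hH0 hH1 hB hψ hσ hvar hM hpair hgroup hj hi
      (3 / 5) (1 / 3) (by norm_num) (by norm_num) gastwirthVariance_pos (gastwirth_mean_eq H hσ j)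
      gastwirthVariance_eq fun n _ => V₂_eq hM n
  refine ⟨fun j hj i hi => ⟨hT j hj i hi, hG j hj i hi⟩, fun hJ => ⟨hurst_eq_olsSlope hJ H _,
    hurst_eq_olsSlope hJ H _, ?_, ?_⟩⟩
  · obtain ⟨h1, h2⟩ := tendsto_sqrt_div_nat tukeyVariance_pos (V₁_eq hM)
    exact tendstoInMeasure_hurstEst hM hJ fun j hj i hi =>
      tendstoInMeasure_of_tendstoInDistribution_div (hT j hj i hi) h1 h2
  · obtain ⟨h1, h2⟩ := tendsto_sqrt_div_nat gastwirthVariance_pos (V₂_eq hM)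
    exact tendstoInMeasure_hurstEst hM hJ fun j hj i hi =>
      tendstoInMeasure_of_tendstoInDistribution_div (hG j hj i hi) h1 h2
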